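/- Let $n\ge 1$, $s\ge 0$, $d=n+s$, $T>0$. Let $\sigma:[0,T]\times\mathbb R^{d}\to\mathbb R^{d\times d}$ and $\mu:[0,T]\times\mathbb R^{d}\to\mathbb R^{d}$ be $C^2$, with $\sigma(t,z)$ invertible for all $(t,z)$; let $y:[0,T]\to\mathbb R^s$ and $\varphi:\mathbb R^n\to\mathbb R$ be $C^2$. For $t\in[0,T]$ and $x,p\in\mathbb R^n$ put $$\psi(t,x,p)=\tfrac12\Bigl|\sigma(t,[x;y_t])^{-1}\bigl([p;\dot y_t]-\mu(t,[x;y_t])\bigr)\Bigr|^2 ,$$ where $[a;b]$ denotes the stacked column vector, and define the action of a $C^1$ path $x:[0,T]\to\mathbb R^n$ by $$-\Lambda(x|y)=\varphi(x_0)+\int_0^T\psi(t,x_t,\dot x_t)\,dt .$$ Let $x^*\in C^2([0,T];\mathbb R^n)$, with $p^*=\dot x^*$, solve the Euler--Lagrange equation with natural boundary conditions: for every $j$, $$0=D_{x_j}\psi-D_tD_{p_j}\psi-\sum_k\dot x^*_k D_{p_j}D_{x_k}\psi-\sum_k\dot p^*_k D_{p_j}D_{p_k}\psi\quad\text{along }(t,x^*_t,p^*_t),\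 t\in[0,T],$$ $$0=D_{p_j}\psi(0,x^*_0,p^*_0)-D_{x_j}\varphi(x^*_0),\qquad 0=D_{p_j}\psi(T,x^*_T,p^*_T).$$ Define the $n\times n$ matrices $A^{ij}_t=D_{x_i}D_{x_j}\psi$, $B^{ij}_t=D_{x_i}D_{p_j}\psi$, $q^{ij}_t=D_{p_i}D_{p_j}\psi$, evaluated at $(t,x^*_t,p^*_t)$. Consider on $[0,T]$ the Riccati problem $$A_t+\dot\theta_t=K_t^Tq_tK_t=(B_t+\theta_t)q_t^{-1}(B_t^T+\theta_t),\qquad \theta_T=0,\qquad\text{where } K_t=q_t^{-1}(B_t^T+\theta_t),\tag{R}$$ and the second-order linear problem $$0=(A_t-\dot B_t^T)F_t+(B_t-B_t^T-\dot q_t)\dot F_t-q_t\ddot F_t,\qquad F_T=I,\qquad B_T^TF_T+q_T\dot F_T=0.\tag{L}$$ Then: (i) If (R) has a unique solution $\theta$ on $[0,T]$, then the first-order linear problem $\dot F_t=-K_tF_t$, $F_T=I$, has a unique solution $F$ on $[0,T]$, and this $F$ solves (L). Moreover, (L) has a unique solution $F$ on $[0,T]$, and: (ii) if $F_t$ is nonsingular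 for every $t\in[0,T]$, then $\theta_t=-q_t\dot F_tF_t^{-1}-B_t^T$ solves (R) on $[0,T]$ and is its unique solution; (iii) if $F_t$ is singular for some $t\in[0,T]$, then $x^*$ is not a local minimizer of the action $-\Lambda(\cdot|y)$ among $C^1$ paths on $[0,T]$ (with free end points), where local is meant in the $C^1$ topology (and hence also for any coarser topology). -/

import Mathlib

open Set Matrix

namespace LeastAction

noncomputable section

/-- The velocity of a path on the time interval `[0, T]` (one-sided at the two ends). -/
def velocity {m : ℕ} (T : ℝ) (x : ℝ → Fin m → ℝ) (t : ℝ) : Fin m → ℝ :=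
  derivWithin x (Icc 0 T) t

/-- The entrywise time derivative on `[0, T]` of a matrix-valued function. -/
def matDeriv {n : ℕ} (T : ℝ) (F : ℝ → Matrix (Fin n) (Fin n) ℝ) (t : ℝ) :
    Matrix (Fin n) (Fin n) ℝ :=
  Matrix.of fun i j => derivWithin (fun r => F r i j) (Icc 0 T) t

/-- Entrywise differentiability on `[0, T]` of a matrix-valued function. -/
def MatDifferentiable {n : ℕ} (T : ℝ) (F : ℝ → Matrix (Fin n) (Fin n) ℝ) : Prop :=
  ∀ i j, DifferentiableOn ℝ (fun r => F r i j) (Icc 0 T)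

/-- The function `ψ(t,x,p) = ½ |σ(t,z)⁻¹ (ż - μ(t,z))|²`, where `z = [x; y_t]` and
`ż = [p; dy_t/dt]`. Stacked vectors are indexed by `Fin n ⊕ Fin s`. -/
def lagrangian {n s : ℕ} (T : ℝ)
    (σ : ℝ → (Fin n ⊕ Fin s → ℝ) → Matrix (Fin n ⊕ Fin s) (Fin n ⊕ Fin s) ℝ)
    (μ : ℝ → (Fin n ⊕ Fin s → ℝ) → (Fin n ⊕ Fin s → ℝ))
    (y : ℝ → Fin s → ℝ) (t : ℝ) (x p : Fin n → ℝ) : ℝ :=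
  let z : Fin n ⊕ Fin s → ℝ := Sum.elim x (y t)
  let v : Fin n ⊕ Fin s → ℝ := (σ t z)⁻¹ *ᵥ (Sum.elim p (velocity T y t) - μ t z)
  1 / 2 * (v ⬝ᵥ v)

/-- The partial derivative in the `i`-th space variable, `D_{x_i} ψ`. -/
def dX {n : ℕ} (i : Fin n) (ψ : ℝ → (Fin n → ℝ) → (Fin n → ℝ) → ℝ)
    (t : ℝ) (x p : Fin n → ℝ) : ℝ :=
  fderiv ℝ (fun x' => ψ t x' p) x (Pi.single i 1)

/-- The partial derivative in the `i`-th velocity variable, `D_{p_i} ψ`. -/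
def dP {n : ℕ} (i : Fin n) (ψ : ℝ → (Fin n → ℝ) → (Fin n → ℝ) → ℝ)
    (t : ℝ) (x p : Fin n → ℝ) : ℝ :=
  fderiv ℝ (fun p' => ψ t x p') p (Pi.single i 1)

/-- The partial derivative in time on `[0, T]`, with `x` and `p` held fixed, `D_t ψ`. -/
def dT {n : ℕ} (T : ℝ) (ψ : ℝ → (Fin n → ℝ) → (Fin n → ℝ) → ℝ)
    (t : ℝ) (x p : Fin n → ℝ) : ℝ :=
  derivWithin (fun r => ψ r x p) (Icc 0 T) t

/-- The action `φ(x_0) + ∫_0^T ψ(t, x_t, dx_t/dt) dt`, the negative log-likelihood of `x`. -/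
def action {n : ℕ} (T : ℝ) (ψ : ℝ → (Fin n → ℝ) → (Fin n → ℝ) → ℝ)
    (φ : (Fin n → ℝ) → ℝ) (x : ℝ → Fin n → ℝ) : ℝ :=
  φ (x 0) + ∫ t in (0 : ℝ)..T, ψ t (x t) (velocity T x t)

/-- `x` is a local minimizer of the action among the `C¹` paths on `[0, T]`, for the
`C¹` topology (both end points are free). -/
def IsLocalMinimizer {n : ℕ} (T : ℝ) (ψ : ℝ → (Fin n → ℝ) → (Fin n → ℝ) → ℝ)
    (φ : (Fin n → ℝ) → ℝ) (x : ℝ → Fin n → ℝ) : Prop :=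
  ContDiffOn ℝ 1 x (Icc 0 T) ∧
  ∃ δ : ℝ, 0 < δ ∧ ∀ u : ℝ → Fin n → ℝ, ContDiffOn ℝ 1 u (Icc 0 T) →
    (∀ t ∈ Icc 0 T, ‖u t - x t‖ < δ ∧ ‖velocity T u t - velocity T x t‖ < δ) →
    action T ψ φ x ≤ action T ψ φ u

/-- `x` is a `C²` solution on `[0, T]` of the Euler-Lagrange equation of the action, with the
two natural boundary conditions. -/
structure IsExtremal {n : ℕ} (T : ℝ) (ψ : ℝ → (Fin n → ℝ) → (Fin n → ℝ) → ℝ)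
    (φ : (Fin n → ℝ) → ℝ) (x : ℝ → Fin n → ℝ) : Prop where
  smooth : ContDiffOn ℝ 2 x (Icc 0 T)
  initial : ∀ j, 0 = dP j ψ 0 (x 0) (velocity T x 0) - fderiv ℝ φ (x 0) (Pi.single j 1)
  ode : ∀ t ∈ Icc 0 T, ∀ j,
    0 = dX j ψ t (x t) (velocity T x t)
      - dT T (dP j ψ) t (x t) (velocity T x t)
      - ∑ k, velocity T x t k * dP j (dX k ψ) t (x t) (velocity T x t)
      - ∑ k, velocity T (velocity T x) t k * dP j (dP k ψ) t (x t) (velocity T x t)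
  terminal : ∀ j, 0 = dP j ψ T (x T) (velocity T x T)

/-- `A^{ij}_t = D_{x_i} D_{x_j} ψ` along the path `x`. -/
def hessXX {n : ℕ} (T : ℝ) (ψ : ℝ → (Fin n → ℝ) → (Fin n → ℝ) → ℝ)
    (x : ℝ → Fin n → ℝ) (t : ℝ) : Matrix (Fin n) (Fin n) ℝ :=
  Matrix.of fun i j => dX i (dX j ψ) t (x t) (velocity T x t)

/-- `B^{ij}_t = D_{x_i} D_{p_j} ψ` along the path `x`. -/
def hessXP {n : ℕ} (T : ℝ) (ψ : ℝ → (Fin n → ℝ) → (Fin n → ℝ) → ℝ)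
    (x : ℝ → Fin n → ℝ) (t : ℝ) : Matrix (Fin n) (Fin n) ℝ :=
  Matrix.of fun i j => dX i (dP j ψ) t (x t) (velocity T x t)

/-- `q^{ij}_t = D_{p_i} D_{p_j} ψ` along the path `x`. -/
def hessPP {n : ℕ} (T : ℝ) (ψ : ℝ → (Fin n → ℝ) → (Fin n → ℝ) → ℝ)
    (x : ℝ → Fin n → ℝ) (t : ℝ) : Matrix (Fin n) (Fin n) ℝ :=
  Matrix.of fun i j => dP i (dP j ψ) t (x t) (velocity T x t)

/-- `K_t = q_t⁻¹ (B_tᵀ + θ_t)`. -/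
def gain {n : ℕ} (B q θ : ℝ → Matrix (Fin n) (Fin n) ℝ) (t : ℝ) : Matrix (Fin n) (Fin n) ℝ :=
  (q t)⁻¹ * ((B t)ᵀ + θ t)

/-- `θ` solves on `[0, T]` the Riccati equation
`A + dθ/dt = Kᵀ q K = (B + θ) q⁻¹ (Bᵀ + θ)` with `θ_T = 0`. -/
structure IsRiccatiSolution {n : ℕ} (T : ℝ) (A B q θ : ℝ → Matrix (Fin n) (Fin n) ℝ) :
    Prop where
  differentiable : MatDifferentiable T θ
  ode : ∀ t ∈ Icc 0 T,
    A t + matDeriv T θ t = (gain B q θ t)ᵀ * q t * gain B q θ t ∧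
    (gain B q θ t)ᵀ * q t * gain B q θ t = (B t + θ t) * (q t)⁻¹ * ((B t)ᵀ + θ t)
  terminal : θ T = 0

/-- `θ` is the unique solution on `[0, T]` of the Riccati equation. -/
def IsUniqueRiccatiSolution {n : ℕ} (T : ℝ) (A B q θ : ℝ → Matrix (Fin n) (Fin n) ℝ) : Prop :=
  IsRiccatiSolution T A B q θ ∧
    ∀ η : ℝ → Matrix (Fin n) (Fin n) ℝ, IsRiccatiSolution T A B q η → EqOn η θ (Icc 0 T)

/-- `F` solves on `[0, T]` the equation `dF/dt = - K F` with `F_T = I`. -/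
structure IsFirstOrderSolution {n : ℕ} (T : ℝ) (K F : ℝ → Matrix (Fin n) (Fin n) ℝ) :
    Prop where
  differentiable : MatDifferentiable T F
  ode : ∀ t ∈ Icc 0 T, matDeriv T F t = -(K t * F t)
  terminal : F T = 1

/-- `F` solves on `[0, T]` the second-order linear equation
`0 = (A - dBᵀ/dt) F + (B - Bᵀ - dq/dt) dF/dt - q d²F/dt²`
with `F_T = I` and `B_Tᵀ F_T + q_T (dF/dt)_T = 0`. -/
structure IsSecondOrderSolution {n : ℕ} (T : ℝ) (A B q F : ℝ → Matrix (Fin n) (Fin n) ℝ) :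
    Prop where
  differentiable : MatDifferentiable T F
  differentiable_deriv : MatDifferentiable T (matDeriv T F)
  ode : ∀ t ∈ Icc 0 T,
    0 = (A t - matDeriv T (fun r => (B r)ᵀ) t) * F t
      + (B t - (B t)ᵀ - matDeriv T q t) * matDeriv T F t
      - q t * matDeriv T (matDeriv T F) t
  terminal : F T = 1
  terminal_deriv : (B T)ᵀ * F T + q T * matDeriv T F T = 0

end

end LeastAction

/-! With the momentum `G = BᵀF + qḞ`, problem (L) becomes a first-order linear Hamiltonian system
for `(F, G)` with terminal value `(I, 0)`, so it has exactly one solution on the whole of `[0, T]`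
(`exists_hamiltonian`, `hamiltonian_unique`). Riccati solutions correspond to `θ = -G F⁻¹`. A
solution `θ` of (R), with the `F` of its first-order problem, gives the Hamiltonian solution `(F,
-θF)`; this yields (i) and the uniqueness in (ii). Conversely, conservation of `FᵀG - GᵀF` makes `-G
F⁻¹` symmetric where `F` is invertible, and differentiating `θF = -G` gives (R).

Part (iii) is Jacobi's conjugate point argument. Let `F v = 0` at `t₀` with `v ≠ 0`, and put `h = F
v`, `g = G v`. The field that is `0` before `t₀` and `h` afterwards has second variation zero, since
`h` vanishes at `t₀` and `g` at `T`, but it has a corner at `t₀`. Adding the constant `ε k`, where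
`k = g(t₀) ≠ 0`, changes the second variation by `-2ε|k|² + O(ε²)`; the Hessian of `φ` enters only
the `O(ε²)`. Rounding the corner costs arbitrarily little, which gives a `C¹` direction of negative
second variation (`exists_negative_variation`). A symmetric second difference of the action then
excludes a local minimum (`not_isLocalMinimizer`).

The velocity of `y` is only `C¹` in time, so the regularity of `ψ` is obtained by treating `y` and
its velocity as free variables. The momentum `D_p ψ` has an explicit formula and is again `C²`,
which makes `B` and `q` of class `C¹` along the path. Finally `q = RᵀR`, where `R` consists of
independent columns of `σ⁻¹`. -/

namespace LeastAction

/-! ### Linear systems on a compact interval: uniqueness and global existence. -/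

section LinearODE

variable {ι κ : Type*} [Fintype ι]

theorem exists_mulVec_norm_le {s : Set ℝ} (hs : IsCompact s) {C : ℝ → Matrix ι ι ℝ}
    (hC : ∀ i j, ContinuousOn (fun t => C t i j) s) :
    ∃ K : NNReal, ∀ t ∈ s, ∀ v : ι → ℝ, ‖C t *ᵥ v‖ ≤ K * ‖v‖ := by
  choose M hM using fun i j => hs.exists_bound_of_continuousOn (hC i j)
  have h0 : ∀ i j, 0 ≤ |M i j| := fun i j => abs_nonneg _
  refine ⟨⟨∑ i, ∑ j, |M i j|, by positivity⟩, fun t ht v => ?_⟩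
  have hK : 0 ≤ ∑ i, ∑ j, |M i j| := by positivity
  refine (pi_norm_le_iff_of_nonneg (mul_nonneg hK (norm_nonneg _))).2 fun i => ?_
  calc ‖(C t *ᵥ v) i‖ ≤ ∑ j, ‖C t i j * v j‖ := norm_sum_le _ _
    _ ≤ ∑ j, |M i j| * ‖v‖ := by
        refine Finset.sum_le_sum fun j _ => ?_
        rw [norm_mul]
        exact mul_le_mul ((hM i j t ht).trans (le_abs_self _)) (norm_le_pi_norm v j)
          (norm_nonneg _) (h0 i j)
    _ = (∑ j, |M i j|) * ‖v‖ := by rw [Finset.sum_mul]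
    _ ≤ (∑ i, ∑ j, |M i j|) * ‖v‖ := by
        refine mul_le_mul_of_nonneg_right ?_ (norm_nonneg _)
        exact Finset.single_le_sum (f := fun i => ∑ j, |M i j|)
          (fun i _ => Finset.sum_nonneg fun j _ => h0 i j) (Finset.mem_univ i)

theorem lipschitzWith_mulVec {C : Matrix ι ι ℝ} {K : NNReal}
    (h : ∀ v : ι → ℝ, ‖C *ᵥ v‖ ≤ K * ‖v‖) : LipschitzWith K (fun v => C *ᵥ v) := by
  refine LipschitzWith.of_dist_le_mul fun a b => ?_
  rw [dist_eq_norm, dist_eq_norm, ← Matrix.mulVec_sub]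
  exact h _

/-- A solution of a homogeneous linear system that vanishes at one time vanishes identically. -/
theorem linear_eq_zero {T : ℝ} {C : ℝ → Matrix ι ι ℝ}
    (hC : ∀ i j, ContinuousOn (fun t => C t i j) (Icc 0 T)) {u : ℝ → ι → ℝ}
    (hu : ∀ t ∈ Icc 0 T, HasDerivWithinAt u (C t *ᵥ u t) (Icc 0 T) t)
    {t₀ : ℝ} (ht₀ : t₀ ∈ Icc 0 T) (h0 : u t₀ = 0) : ∀ t ∈ Icc 0 T, u t = 0 := by
  obtain ⟨K, hK⟩ := exists_mulVec_norm_le isCompact_Icc hC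
  have hcont : ContinuousOn u (Icc 0 T) := fun t ht => (hu t ht).continuousWithinAt
  intro t ht
  rcases le_total t₀ t with h | h
  · have := ODE_solution_unique_of_mem_Icc_right (v := fun t x => C t *ᵥ x) (K := K)
      (s := fun _ => univ) (f := u) (g := fun _ => 0) (a := t₀) (b := T)
      (fun r hr => (lipschitzWith_mulVec (hK r ⟨ht₀.1.trans hr.1, hr.2.le⟩)).lipschitzOnWith)
      (hcont.mono (Icc_subset_Icc_left ht₀.1))
      (fun r hr => (hu r ⟨ht₀.1.trans hr.1, hr.2.le⟩).mono_of_mem_nhdsWithin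
        (Icc_mem_nhdsGE_of_mem ⟨ht₀.1.trans hr.1, hr.2⟩))
      (fun _ _ => trivial) continuousOn_const
      (fun r hr => by simpa using hasDerivWithinAt_const r (Ici r) (0 : ι → ℝ))
      (fun _ _ => trivial) h0
    exact this ⟨h, ht.2⟩
  · have := ODE_solution_unique_of_mem_Icc_left (v := fun t x => C t *ᵥ x) (K := K)
      (s := fun _ => univ) (f := u) (g := fun _ => 0) (a := 0) (b := t₀)
      (fun r hr => (lipschitzWith_mulVec (hK r ⟨hr.1.le, hr.2.trans ht₀.2⟩)).lipschitzOnWith)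
      (hcont.mono (Icc_subset_Icc_right ht₀.2))
      (fun r hr => (hu r ⟨hr.1.le, hr.2.trans ht₀.2⟩).mono_of_mem_nhdsWithin
        (Icc_mem_nhdsLE_of_mem ⟨hr.1, hr.2.trans ht₀.2⟩))
      (fun _ _ => trivial) continuousOn_const
      (fun r hr => by simpa using hasDerivWithinAt_const r (Iic r) (0 : ι → ℝ))
      (fun _ _ => trivial) h0
    exact this ⟨ht.1, h⟩

/-- Truncation of all coordinates to `[-R, R]`. -/
def clampVec (R : ℝ) (v : ι → ℝ) : ι → ℝ := fun i => max (-R) (min R (v i))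

theorem lipschitzWith_clampVec (R : ℝ) : LipschitzWith 1 (clampVec (ι := ι) R) := by
  refine LipschitzWith.of_dist_le_mul fun a b => ?_
  rw [NNReal.coe_one, one_mul]
  refine (dist_pi_le_iff dist_nonneg).2 fun i => ?_
  refine le_trans ?_ (dist_le_pi_dist a b i)
  simp only [clampVec, Real.dist_eq]
  calc |max (-R) (min R (a i)) - max (-R) (min R (b i))|
      ≤ |min R (a i) - min R (b i)| := by
        simpa using abs_max_sub_max_le_max (-R) (min R (a i)) (-R) (min R (b i))
    _ ≤ |a i - b i| := by
        simpa using abs_min_sub_min_le_max R (a i) R (b i)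

theorem norm_clampVec_le {R : ℝ} (hR : 0 ≤ R) (v : ι → ℝ) : ‖clampVec R v‖ ≤ R := by
  refine (pi_norm_le_iff_of_nonneg hR).2 fun i => ?_
  rw [Real.norm_eq_abs, abs_le]
  exact ⟨le_max_left _ _, max_le (by linarith) (min_le_left _ _)⟩

theorem norm_clampVec_le_norm {R : ℝ} (hR : 0 ≤ R) (v : ι → ℝ) : ‖clampVec R v‖ ≤ ‖v‖ := by
  have := (lipschitzWith_clampVec (ι := ι) R).dist_le_mul v 0
  have h0 : clampVec R (0 : ι → ℝ) = 0 := by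
    funext i
    simp [clampVec, hR]
  simpa [h0, dist_eq_norm] using this

theorem clampVec_eq_self {R : ℝ} {v : ι → ℝ} (h : ‖v‖ ≤ R) : clampVec R v = v := by
  funext i
  have := abs_le.1 ((norm_le_pi_norm v i).trans h)
  simp only [clampVec]
  rw [min_eq_right this.2, max_eq_right this.1]

/-- Picard-Lindelöf reaches the whole interval once the field is bounded, so the argument of `C t`
is truncated at radius `R`. Truncation does not increase norms, so Grönwall bounds the solution by
`‖c‖ exp(KT) = R`, and the truncation was never active. -/
theorem exists_linear_initial {T : ℝ} (hT : 0 ≤ T) {C : ℝ → Matrix ι ι ℝ}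
    (hC : ∀ i j, ContinuousOn (fun t => C t i j) (Icc 0 T)) (c : ι → ℝ) :
    ∃ u : ℝ → ι → ℝ, u 0 = c ∧
      ∀ t ∈ Icc 0 T, HasDerivWithinAt u (C t *ᵥ u t) (Icc 0 T) t := by
  obtain ⟨K, hK⟩ := exists_mulVec_norm_le isCompact_Icc hC
  set R : NNReal := ⟨‖c‖ * Real.exp (K * T), by positivity⟩ with hR
  have hRv : (R : ℝ) = ‖c‖ * Real.exp (K * T) := rfl
  set f : ℝ → (ι → ℝ) → (ι → ℝ) := fun t v => C t *ᵥ clampVec R v with hf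
  have hnorm : ∀ t ∈ Icc 0 T, ∀ v, ‖f t v‖ ≤ (K * R : NNReal) := fun t ht v =>
    (hK t ht _).trans (by
      rw [NNReal.coe_mul]
      exact mul_le_mul_of_nonneg_left (norm_clampVec_le R.2 v) K.2)
  have hPL : IsPicardLindelof f (tmin := 0) (tmax := T) ⟨0, left_mem_Icc.2 hT⟩ c
      (K * R * ⟨T, hT⟩) 0 (K * R) K := by
    refine ⟨fun t ht => ?_, fun v _ => ?_, fun t ht v _ => hnorm t ht v, ?_⟩
    · have := (lipschitzWith_mulVec (hK t ht)).comp (lipschitzWith_clampVec (ι := ι) R)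
      rw [mul_one] at this
      exact this.lipschitzOnWith
    · refine continuousOn_pi.2 fun i => ?_
      simp only [hf, Matrix.mulVec, dotProduct]
      exact continuousOn_finsetSum _ fun j _ => (hC i j).mul continuousOn_const
    · simp only [sub_zero, sub_self, NNReal.coe_zero, max_eq_left hT]
      exact le_rfl
  obtain ⟨u, hu0, hu⟩ := hPL.exists_eq_forall_mem_Icc_hasDerivWithinAt₀
  refine ⟨u, hu0, fun t ht => ?_⟩
  have hb := norm_le_gronwallBound_of_norm_deriv_right_le (f := u) (f' := fun t => f t (u t))
    (δ := ‖c‖) (K := K) (ε := 0) (a := 0) (b := T)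
    (fun t ht => (hu t ht).continuousWithinAt)
    (fun r hr => (hu r ⟨hr.1, hr.2.le⟩).mono_of_mem_nhdsWithin (Icc_mem_nhdsGE_of_mem hr))
    (by rw [show u 0 = c from hu0])
    (fun r hr => by
      rw [add_zero]
      exact (hK r ⟨hr.1, hr.2.le⟩ _).trans
        (mul_le_mul_of_nonneg_left (norm_clampVec_le_norm R.2 _) K.2)) t ht
  have hle : ‖u t‖ ≤ R := by
    rw [gronwallBound_ε0, sub_zero] at hb
    rw [hRv]
    refine hb.trans (mul_le_mul_of_nonneg_left ?_ (norm_nonneg _))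
    exact Real.exp_le_exp.2 (mul_le_mul_of_nonneg_left ht.2 K.2)
  have := hu t ht
  simp only [hf] at this
  rwa [clampVec_eq_self hle] at this

theorem mapsTo_reflect {T : ℝ} : MapsTo (fun t : ℝ => T - t) (Icc 0 T) (Icc 0 T) :=
  fun _ ht => ⟨by linarith [ht.2], by linarith [ht.1]⟩

/-- Time reversal `t ↦ T - t` turns this into an initial value problem for `-C (T - t)`. -/
theorem exists_linear_terminal {T : ℝ} (hT : 0 ≤ T) {C : ℝ → Matrix ι ι ℝ}
    (hC : ∀ i j, ContinuousOn (fun t => C t i j) (Icc 0 T)) (c : ι → ℝ) :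
    ∃ u : ℝ → ι → ℝ, u T = c ∧
      ∀ t ∈ Icc 0 T, HasDerivWithinAt u (C t *ᵥ u t) (Icc 0 T) t := by
  obtain ⟨v, hv0, hv⟩ := exists_linear_initial hT (C := fun t => -C (T - t))
    (fun i j => ((hC i j).comp (by fun_prop) mapsTo_reflect).neg) c
  refine ⟨fun t => v (T - t), by simpa using hv0, fun t ht => ?_⟩
  have h1 : HasDerivWithinAt (fun t : ℝ => T - t) (-1) (Icc 0 T) t := by
    simpa using (hasDerivWithinAt_id t (Icc 0 T)).const_sub T
  have := (hv (T - t) (mapsTo_reflect ht)).scomp t h1 mapsTo_reflect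
  simpa [Function.comp_def, Matrix.neg_mulVec] using this

end LinearODE

/-! ### Entrywise calculus of matrix-valued functions. -/

section EntryDeriv

variable {k l m : Type*}

/-- Entrywise derivative on `[0, T]` of a matrix-valued function. -/
def HasEntryDeriv (T : ℝ) (F : ℝ → Matrix k l ℝ) (F' : Matrix k l ℝ) (t : ℝ) : Prop :=
  ∀ i j, HasDerivWithinAt (fun r => F r i j) (F' i j) (Icc 0 T) t

variable {T t : ℝ} {F G : ℝ → Matrix k l ℝ} {F' G' : Matrix k l ℝ}

theorem HasEntryDeriv.congr_deriv (hF : HasEntryDeriv T F F' t) (h : F' = G') :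
    HasEntryDeriv T F G' t := h ▸ hF

theorem HasEntryDeriv.congr (hF : HasEntryDeriv T F F' t) (h : EqOn G F (Icc 0 T))
    (ht : t ∈ Icc 0 T) : HasEntryDeriv T G F' t := fun i j =>
  (hF i j).congr (fun r hr => by rw [h hr]) (by rw [h ht])

theorem HasEntryDeriv.neg (hF : HasEntryDeriv T F F' t) :
    HasEntryDeriv T (fun r => -F r) (-F') t := fun i j => (hF i j).fun_neg

theorem HasEntryDeriv.add (hF : HasEntryDeriv T F F' t) (hG : HasEntryDeriv T G G' t) :
    HasEntryDeriv T (fun r => F r + G r) (F' + G') t := fun i j => (hF i j).fun_add (hG i j)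

theorem HasEntryDeriv.sub (hF : HasEntryDeriv T F F' t) (hG : HasEntryDeriv T G G' t) :
    HasEntryDeriv T (fun r => F r - G r) (F' - G') t := fun i j => (hF i j).fun_sub (hG i j)

theorem HasEntryDeriv.transpose (hF : HasEntryDeriv T F F' t) :
    HasEntryDeriv T (fun r => (F r)ᵀ) F'ᵀ t := fun i j => hF j i

theorem HasEntryDeriv.mul [Fintype l] {H : ℝ → Matrix l m ℝ} {H' : Matrix l m ℝ}
    (hF : HasEntryDeriv T F F' t) (hH : HasEntryDeriv T H H' t) :
    HasEntryDeriv T (fun r => F r * H r) (F' * H t + F t * H') t := fun i j => by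
  simp only [Matrix.mul_apply, Matrix.add_apply, ← Finset.sum_add_distrib]
  exact HasDerivWithinAt.fun_sum fun a _ => (hF i a).fun_mul (hH a j)

theorem HasEntryDeriv.unique (hT : 0 < T) (ht : t ∈ Icc 0 T) (hF : HasEntryDeriv T F F' t)
    (hG : HasEntryDeriv T F G' t) : F' = G' := by
  ext i j
  exact (uniqueDiffOn_Icc hT t ht).eq_deriv _ (hF i j) (hG i j)

theorem eq_of_hasEntryDeriv_zero (hT : 0 < T) (h : ∀ t ∈ Icc 0 T, HasEntryDeriv T F 0 t)
    (ht : t ∈ Icc 0 T) : F t = F T := by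
  ext i j
  have key := constant_of_has_deriv_right_zero (f := fun r => F r i j) (a := 0) (b := T)
    (fun r hr => (h r hr i j).continuousWithinAt)
    (fun r hr => (h r ⟨hr.1, hr.2.le⟩ i j).mono_of_mem_nhdsWithin (Icc_mem_nhdsGE_of_mem hr))
  exact (key t ht).trans (key T (right_mem_Icc.2 hT.le)).symm

variable {n : ℕ} {X : ℝ → Matrix (Fin n) (Fin n) ℝ} {X' : Matrix (Fin n) (Fin n) ℝ}

theorem HasEntryDeriv.matDeriv_eq (hT : 0 < T) (ht : t ∈ Icc 0 T) (hX : HasEntryDeriv T X X' t) :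
    matDeriv T X t = X' := by
  ext i j
  exact (hX i j).derivWithin (uniqueDiffOn_Icc hT t ht)

theorem MatDifferentiable.hasEntryDeriv (hX : MatDifferentiable T X) (ht : t ∈ Icc 0 T) :
    HasEntryDeriv T X (matDeriv T X t) t := fun i j => (hX i j t ht).hasDerivWithinAt

theorem matDifferentiable_of_hasEntryDeriv (h : ∀ t ∈ Icc 0 T, ∃ X', HasEntryDeriv T X X' t) :
    MatDifferentiable T X :=
  fun i j t ht => ((h t ht).choose_spec i j).differentiableWithinAt

theorem MatDifferentiable.congr {Y : ℝ → Matrix (Fin n) (Fin n) ℝ} (hX : MatDifferentiable T X)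
    (h : EqOn Y X (Icc 0 T)) : MatDifferentiable T Y :=
  fun i j => (hX i j).congr fun r hr => by rw [h hr]

end EntryDeriv

/-! ### Linear matrix equations; smoothness of determinants and inverses. -/

section Matrix

variable {ι κ : Type*} [Fintype ι]

/-- Terminal value problem for a linear matrix equation. -/
theorem exists_linear_matrix {T : ℝ} (hT : 0 ≤ T) {C : ℝ → Matrix ι ι ℝ}
    (hC : ∀ i j, ContinuousOn (fun t => C t i j) (Icc 0 T)) (c : Matrix ι κ ℝ) :
    ∃ Y : ℝ → Matrix ι κ ℝ, Y T = c ∧ ∀ t ∈ Icc 0 T, HasEntryDeriv T Y (C t * Y t) t := by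
  choose u hu0 hu using fun j => exists_linear_terminal hT hC (fun i => c i j)
  refine ⟨fun t => Matrix.of fun i j => u j t i, ?_, fun t ht i j => ?_⟩
  · ext i j
    simp [hu0]
  · exact hasDerivWithinAt_pi.1 (hu j t ht) i

theorem linear_matrix_unique {T : ℝ} (hT : 0 ≤ T) {C : ℝ → Matrix ι ι ℝ}
    (hC : ∀ i j, ContinuousOn (fun t => C t i j) (Icc 0 T)) {Y Z : ℝ → Matrix ι κ ℝ}
    (hY : ∀ t ∈ Icc 0 T, HasEntryDeriv T Y (C t * Y t) t)
    (hZ : ∀ t ∈ Icc 0 T, HasEntryDeriv T Z (C t * Z t) t) (h : Y T = Z T) :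
    EqOn Y Z (Icc 0 T) := by
  intro t ht
  ext i j
  have := linear_eq_zero hC (u := fun t i => Y t i j - Z t i j) (fun t ht => by
    refine hasDerivWithinAt_pi.2 fun i => ?_
    refine ((hY t ht i j).fun_sub (hZ t ht i j)).congr_deriv ?_
    simp [Matrix.mul_apply, Matrix.mulVec, dotProduct, mul_sub])
    (right_mem_Icc.2 hT) (by funext i; simp [h]) t ht
  exact sub_eq_zero.1 (congrFun this i)

variable [DecidableEq ι] {E : Type*} [NormedAddCommGroup E] [NormedSpace ℝ E] {N : ℕ∞}
  {s : Set E} {M : E → Matrix ι ι ℝ}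

theorem contDiffOn_det (h : ∀ i j, ContDiffOn ℝ N (fun w => M w i j) s) :
    ContDiffOn ℝ N (fun w => (M w).det) s := by
  simp only [Matrix.det_apply]
  exact ContDiffOn.sum fun τ _ => (contDiffOn_prod fun i _ => h _ _).const_smul _

/-- Cramer's rule: adjugate entries are determinants of matrices with smooth entries, and the
determinant does not vanish. -/
theorem contDiffOn_inv_entry (h : ∀ i j, ContDiffOn ℝ N (fun w => M w i j) s)
    (hu : ∀ w ∈ s, IsUnit (M w)) (i j : ι) : ContDiffOn ℝ N (fun w => (M w)⁻¹ i j) s := by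
  have hdet : ∀ w ∈ s, (M w).det ≠ 0 := fun w hw =>
    ((Matrix.isUnit_iff_isUnit_det _).1 (hu w hw)).ne_zero
  have hadj : ContDiffOn ℝ N (fun w => (M w).adjugate i j) s := by
    simp only [Matrix.adjugate_apply]
    refine contDiffOn_det fun a b => ?_
    by_cases hab : a = j
    · subst hab
      simp only [Matrix.updateRow_self]
      exact contDiffOn_const
    · simp only [Matrix.updateRow_ne hab]
      exact h a b
  simp only [Matrix.inv_def, Ring.inverse_eq_inv', Matrix.smul_apply, smul_eq_mul]
  exact ((contDiffOn_det h).inv hdet).mul hadj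

end Matrix

/-! ### The Hamiltonian system, the second-order problem and the Riccati equation. -/

section Hamiltonian

variable {n : ℕ} {T : ℝ} {A B q F G θ : ℝ → Matrix (Fin n) (Fin n) ℝ}

/-- Regularity of the coefficients of the linearized Euler-Lagrange equation. -/
structure IsRegularHessian (T : ℝ) (A B q : ℝ → Matrix (Fin n) (Fin n) ℝ) : Prop where
  continuousOn_A : ∀ i j, ContinuousOn (fun t => A t i j) (Icc 0 T)
  contDiffOn_B : ∀ i j, ContDiffOn ℝ 1 (fun t => B t i j) (Icc 0 T)
  contDiffOn_q : ∀ i j, ContDiffOn ℝ 1 (fun t => q t i j) (Icc 0 T)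
  symm_A : ∀ t ∈ Icc 0 T, (A t)ᵀ = A t
  symm_q : ∀ t ∈ Icc 0 T, (q t)ᵀ = q t
  isUnit_q : ∀ t ∈ Icc 0 T, IsUnit (q t)

/-- The first order system in `F` and the momentum `G = Bᵀ F + q dF/dt` that is equivalent to the
second-order linear equation. -/
def IsHamiltonianSolution (T : ℝ) (A B q F G : ℝ → Matrix (Fin n) (Fin n) ℝ) : Prop :=
  ∀ t ∈ Icc 0 T, HasEntryDeriv T F ((q t)⁻¹ * (G t - (B t)ᵀ * F t)) t ∧
    HasEntryDeriv T G (A t * F t + B t * ((q t)⁻¹ * (G t - (B t)ᵀ * F t))) t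

/-- The matrix of the Hamiltonian system. -/
noncomputable def hamiltonianMatrix (A B q : Matrix (Fin n) (Fin n) ℝ) :
    Matrix (Fin n ⊕ Fin n) (Fin n ⊕ Fin n) ℝ :=
  Matrix.fromBlocks (-(q⁻¹ * Bᵀ)) q⁻¹ (A - B * (q⁻¹ * Bᵀ)) (B * q⁻¹)

theorem hamiltonianMatrix_mul (A B q F G : Matrix (Fin n) (Fin n) ℝ) :
    hamiltonianMatrix A B q * Matrix.fromRows F G =
      Matrix.fromRows (q⁻¹ * (G - Bᵀ * F)) (A * F + B * (q⁻¹ * (G - Bᵀ * F))) := by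
  rw [hamiltonianMatrix, Matrix.fromBlocks_mul_fromRows]
  congr 1 <;> noncomm_ring

namespace IsRegularHessian

theorem q_mul_inv (h : IsRegularHessian T A B q) {t : ℝ} (ht : t ∈ Icc 0 T) :
    q t * (q t)⁻¹ = 1 :=
  Matrix.mul_nonsing_inv _ ((Matrix.isUnit_iff_isUnit_det _).1 (h.isUnit_q t ht))

theorem inv_mul_q (h : IsRegularHessian T A B q) {t : ℝ} (ht : t ∈ Icc 0 T) :
    (q t)⁻¹ * q t = 1 :=
  Matrix.nonsing_inv_mul _ ((Matrix.isUnit_iff_isUnit_det _).1 (h.isUnit_q t ht))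

theorem symm_q_inv (h : IsRegularHessian T A B q) {t : ℝ} (ht : t ∈ Icc 0 T) :
    ((q t)⁻¹)ᵀ = (q t)⁻¹ := by
  rw [Matrix.transpose_nonsing_inv, h.symm_q t ht]

theorem contDiffOn_q_inv (h : IsRegularHessian T A B q) (i j : Fin n) :
    ContDiffOn ℝ 1 (fun t => (q t)⁻¹ i j) (Icc 0 T) :=
  contDiffOn_inv_entry (N := 1) h.contDiffOn_q h.isUnit_q i j

theorem differentiable_B (h : IsRegularHessian T A B q) : MatDifferentiable T B :=
  fun i j => (h.contDiffOn_B i j).differentiableOn one_ne_zero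

theorem differentiable_q (h : IsRegularHessian T A B q) : MatDifferentiable T q :=
  fun i j => (h.contDiffOn_q i j).differentiableOn one_ne_zero

theorem differentiable_q_inv (h : IsRegularHessian T A B q) :
    MatDifferentiable T (fun t => (q t)⁻¹) :=
  fun i j => (h.contDiffOn_q_inv i j).differentiableOn one_ne_zero

end IsRegularHessian

theorem continuousOn_mul_entry {k l m : Type*} [Fintype l] {s : Set ℝ} {M : ℝ → Matrix k l ℝ}
    {N : ℝ → Matrix l m ℝ}
    (hM : ∀ i j, ContinuousOn (fun t => M t i j) s)
    (hN : ∀ i j, ContinuousOn (fun t => N t i j) s) (i : k) (j : m) :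
    ContinuousOn (fun t => (M t * N t) i j) s := by
  simp only [Matrix.mul_apply]
  exact continuousOn_finsetSum _ fun a _ => (hM i a).mul (hN a j)

theorem IsRegularHessian.continuousOn_hamiltonianMatrix (h : IsRegularHessian T A B q)
    (i j : Fin n ⊕ Fin n) :
    ContinuousOn (fun t => hamiltonianMatrix (A t) (B t) (q t) i j) (Icc 0 T) := by
  have hB := fun i j => (h.contDiffOn_B i j).continuousOn
  have hq := fun i j => (h.contDiffOn_q_inv i j).continuousOn
  have hqB := continuousOn_mul_entry hq (N := fun t => (B t)ᵀ) fun i j => hB j i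
  rcases i with i | i <;> rcases j with j | j
  · exact (hqB i j).neg
  · exact hq i j
  · exact (h.continuousOn_A i j).sub (continuousOn_mul_entry hB hqB i j)
  · exact continuousOn_mul_entry hB hq i j

theorem hasEntryDeriv_fromRows {k₁ k₂ m : Type*} {F : ℝ → Matrix k₁ m ℝ} {G : ℝ → Matrix k₂ m ℝ}
    {F' : Matrix k₁ m ℝ} {G' : Matrix k₂ m ℝ} {t : ℝ} :
    HasEntryDeriv T (fun r => Matrix.fromRows (F r) (G r)) (Matrix.fromRows F' G') t ↔
      HasEntryDeriv T F F' t ∧ HasEntryDeriv T G G' t :=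
  ⟨fun h => ⟨fun i j => h (Sum.inl i) j, fun i j => h (Sum.inr i) j⟩,
    fun h i j => by rcases i with i | i; exacts [h.1 i j, h.2 i j]⟩

theorem IsHamiltonianSolution.hasEntryDeriv (h : IsHamiltonianSolution T A B q F G) {t : ℝ}
    (ht : t ∈ Icc 0 T) :
    HasEntryDeriv T (fun r => Matrix.fromRows (F r) (G r))
      (hamiltonianMatrix (A t) (B t) (q t) * Matrix.fromRows (F t) (G t)) t := by
  rw [hamiltonianMatrix_mul]
  exact hasEntryDeriv_fromRows.2 (h t ht)

theorem IsRegularHessian.exists_hamiltonian (h : IsRegularHessian T A B q) (hT : 0 ≤ T) :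
    ∃ F G, IsHamiltonianSolution T A B q F G ∧ F T = 1 ∧ G T = 0 := by
  obtain ⟨Y, hYT, hY⟩ := exists_linear_matrix hT h.continuousOn_hamiltonianMatrix
    (Matrix.fromRows (1 : Matrix (Fin n) (Fin n) ℝ) 0)
  refine ⟨fun t => (Y t).toRows₁, fun t => (Y t).toRows₂, fun t ht => ?_, ?_, ?_⟩
  · have := hY t ht
    rw [← Matrix.fromRows_toRows (Y t), hamiltonianMatrix_mul] at this
    exact ⟨fun i j => this (Sum.inl i) j, fun i j => this (Sum.inr i) j⟩
  · simp [hYT]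
  · simp [hYT]

theorem IsRegularHessian.hamiltonian_unique (h : IsRegularHessian T A B q) (hT : 0 ≤ T)
    {F₁ G₁ F₂ G₂ : ℝ → Matrix (Fin n) (Fin n) ℝ}
    (h₁ : IsHamiltonianSolution T A B q F₁ G₁) (h₂ : IsHamiltonianSolution T A B q F₂ G₂)
    (hF : F₁ T = F₂ T) (hG : G₁ T = G₂ T) :
    EqOn F₁ F₂ (Icc 0 T) ∧ EqOn G₁ G₂ (Icc 0 T) := by
  have key := linear_matrix_unique hT h.continuousOn_hamiltonianMatrix
    (fun t ht => h₁.hasEntryDeriv ht) (fun t ht => h₂.hasEntryDeriv ht) (by simp [hF, hG])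
  exact ⟨fun t ht => (Matrix.fromRows_ext_iff _ _ _ _ |>.1 (key ht)).1,
    fun t ht => (Matrix.fromRows_ext_iff _ _ _ _ |>.1 (key ht)).2⟩

/-- The equation arises by differentiating `q Ḟ = G - BᵀF` in two ways. Differentiability of `Ḟ`
comes from its expression through `q⁻¹`, `G`, `B` and `F`. -/
theorem IsHamiltonianSolution.isSecondOrderSolution (hF : IsHamiltonianSolution T A B q F G)
    (h : IsRegularHessian T A B q) (hT : 0 < T) (h1 : F T = 1) (h0 : G T = 0) :
    IsSecondOrderSolution T A B q F := by
  have hd : EqOn (matDeriv T F) (fun t => (q t)⁻¹ * (G t - (B t)ᵀ * F t)) (Icc 0 T) :=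
    fun t ht => (hF t ht).1.matDeriv_eq hT ht
  have hqd : EqOn (fun t => q t * matDeriv T F t) (fun t => G t - (B t)ᵀ * F t) (Icc 0 T) := by
    intro t ht
    simp only [hd ht, ← Matrix.mul_assoc, h.q_mul_inv ht, Matrix.one_mul]
  have hdF : MatDifferentiable T (matDeriv T F) := by
    refine MatDifferentiable.congr (matDifferentiable_of_hasEntryDeriv fun t ht => ⟨_,
      (h.differentiable_q_inv.hasEntryDeriv ht).mul ((hF t ht).2.sub
        ((h.differentiable_B.hasEntryDeriv ht).transpose.mul (hF t ht).1))⟩) hd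
  refine ⟨matDifferentiable_of_hasEntryDeriv fun t ht => ⟨_, (hF t ht).1⟩, hdF, fun t ht => ?_, h1, ?_⟩
  · have e1 := (h.differentiable_q.hasEntryDeriv ht).mul (hdF.hasEntryDeriv ht)
    have e2 := ((hF t ht).2.sub
      ((h.differentiable_B.hasEntryDeriv ht).transpose.mul (hF t ht).1)).congr hqd ht
    have e3 := e1.unique hT ht e2
    have e4 : matDeriv T (fun r => (B r)ᵀ) t = (matDeriv T B t)ᵀ :=
      (h.differentiable_B.hasEntryDeriv ht).transpose.matDeriv_eq hT ht
    simp only [← hd ht] at e3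
    rw [e4, eq_sub_of_add_eq' e3]
    noncomm_ring
  · have := hqd (right_mem_Icc.2 hT.le)
    simp only at this
    rw [this, h0]
    abel

/-- The second-order equation says precisely that the derivative of `BᵀF + qḞ` is `AF + BḞ`. -/
theorem IsSecondOrderSolution.isHamiltonianSolution (hF : IsSecondOrderSolution T A B q F)
    (h : IsRegularHessian T A B q) (hT : 0 < T) :
    IsHamiltonianSolution T A B q F (fun t => (B t)ᵀ * F t + q t * matDeriv T F t) := by
  intro t ht
  have e0 : (q t)⁻¹ * ((B t)ᵀ * F t + q t * matDeriv T F t - (B t)ᵀ * F t) = matDeriv T F t := by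
    rw [add_sub_cancel_left, ← Matrix.mul_assoc, h.inv_mul_q ht, Matrix.one_mul]
  have hF' := hF.differentiable.hasEntryDeriv ht
  have hB' := (h.differentiable_B.hasEntryDeriv ht).transpose
  refine ⟨hF'.congr_deriv e0.symm, ?_⟩
  simp only [e0]
  refine ((hB'.mul hF').add ((h.differentiable_q.hasEntryDeriv ht).mul
    (hF.differentiable_deriv.hasEntryDeriv ht))).congr_deriv ?_
  have e := hF.ode t ht
  rw [hB'.matDeriv_eq hT ht] at e
  rw [← sub_eq_zero.1 e.symm]
  noncomm_ring

theorem IsRegularHessian.secondOrder_unique (h : IsRegularHessian T A B q) (hT : 0 < T)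
    (hH : IsHamiltonianSolution T A B q F G) (h1 : F T = 1) (h0 : G T = 0)
    {E : ℝ → Matrix (Fin n) (Fin n) ℝ} (hE : IsSecondOrderSolution T A B q E) :
    EqOn E F (Icc 0 T) :=
  (h.hamiltonian_unique hT.le (hE.isHamiltonianSolution h hT) hH (hE.terminal.trans h1.symm)
    (hE.terminal_deriv.trans h0.symm)).1

theorem IsHamiltonianSolution.momentum_eq (hF : IsHamiltonianSolution T A B q F G)
    (h : IsRegularHessian T A B q) (hT : 0 < T) {t : ℝ} (ht : t ∈ Icc 0 T) :
    q t * matDeriv T F t = G t - (B t)ᵀ * F t := by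
  rw [(hF t ht).1.matDeriv_eq hT ht, ← Matrix.mul_assoc, h.q_mul_inv ht, Matrix.one_mul]

/-- The first order equation of a Riccati solution is solvable, and the solution satisfies
the Hamiltonian system with momentum `- θ F`. -/
theorem IsRiccatiSolution.isHamiltonianSolution (hθ : IsRiccatiSolution T A B q θ)
    (hF : IsFirstOrderSolution T (gain B q θ) F) :
    IsHamiltonianSolution T A B q F (fun t => -(θ t * F t)) := by
  intro t ht
  have e0 : (q t)⁻¹ * (-(θ t * F t) - (B t)ᵀ * F t) = -(gain B q θ t * F t) := by
    rw [gain]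
    noncomm_ring
  have hF' := (hF.differentiable.hasEntryDeriv ht).congr_deriv (hF.ode t ht)
  refine ⟨hF'.congr_deriv e0.symm, ?_⟩
  simp only [e0]
  refine ((hθ.differentiable.hasEntryDeriv ht).mul hF').neg.congr_deriv ?_
  have e := hθ.ode t ht
  -- Both equalities of the Riccati equation enter: `KᵀqK` is traded for `(B + θ)K`, so symmetry of
  -- `θ` is not needed.
  have e1 : matDeriv T θ t = (B t + θ t) * gain B q θ t - A t := by
    rw [eq_sub_iff_add_eq', e.1, e.2, gain, Matrix.mul_assoc]
  rw [e1]
  noncomm_ring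

theorem IsRiccatiSolution.continuousOn_gain (hθ : IsRiccatiSolution T A B q θ)
    (h : IsRegularHessian T A B q) (i j : Fin n) :
    ContinuousOn (fun t => gain B q θ t i j) (Icc 0 T) :=
  continuousOn_mul_entry (fun i j => (h.contDiffOn_q_inv i j).continuousOn)
    (N := fun t => (B t)ᵀ + θ t)
    (fun i j => (h.contDiffOn_B j i).continuousOn.add (hθ.differentiable i j).continuousOn) i j

theorem IsRiccatiSolution.exists_firstOrder (hθ : IsRiccatiSolution T A B q θ)
    (h : IsRegularHessian T A B q) (hT : 0 < T) :
    ∃ F, IsFirstOrderSolution T (gain B q θ) F ∧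
      ∀ E, IsFirstOrderSolution T (gain B q θ) E → EqOn E F (Icc 0 T) := by
  have hc : ∀ i j, ContinuousOn (fun t => (-gain B q θ t) i j) (Icc 0 T) :=
    fun i j => (hθ.continuousOn_gain h i j).neg
  obtain ⟨F, hFT, hF⟩ := exists_linear_matrix hT.le hc (1 : Matrix (Fin n) (Fin n) ℝ)
  refine ⟨F, ⟨matDifferentiable_of_hasEntryDeriv fun t ht => ⟨_, hF t ht⟩, fun t ht => ?_, hFT⟩, fun E hE => ?_⟩
  · rw [(hF t ht).matDeriv_eq hT ht, Matrix.neg_mul]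
  · refine linear_matrix_unique hT.le hc (fun t ht => ?_) hF (hE.terminal.trans hFT.symm)
    refine (hE.differentiable.hasEntryDeriv ht).congr_deriv ?_
    rw [hE.ode t ht, Matrix.neg_mul]

/-- Symmetry of `A` and `q` makes `FᵀG - GᵀF` constant in time, and it vanishes at `T` because `G`
does. -/
theorem IsHamiltonianSolution.symplectic (hF : IsHamiltonianSolution T A B q F G)
    (h : IsRegularHessian T A B q) (hT : 0 < T) (h0 : G T = 0) {t : ℝ} (ht : t ∈ Icc 0 T) :
    (F t)ᵀ * G t = (G t)ᵀ * F t := by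
  have key : ∀ t ∈ Icc 0 T,
      HasEntryDeriv T (fun r => (F r)ᵀ * G r - (G r)ᵀ * F r) 0 t := by
    intro t ht
    refine (((hF t ht).1.transpose.mul (hF t ht).2).sub
      ((hF t ht).2.transpose.mul (hF t ht).1)).congr_deriv ?_
    simp only [Matrix.transpose_mul, Matrix.transpose_add, Matrix.transpose_sub,
      Matrix.transpose_transpose, h.symm_q_inv ht, h.symm_A t ht]
    noncomm_ring
  have := eq_of_hasEntryDeriv_zero hT key ht
  simp only [h0, Matrix.mul_zero, Matrix.transpose_zero, Matrix.zero_mul, sub_zero] at this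
  exact sub_eq_zero.1 this

/-- Supplies the regularity from which `contDiffOn_inv_entry` gives differentiability of `F⁻¹`. -/
theorem IsHamiltonianSolution.contDiffOn_entry (hF : IsHamiltonianSolution T A B q F G)
    (h : IsRegularHessian T A B q) (hT : 0 < T) (i j : Fin n) :
    ContDiffOn ℝ 1 (fun t => F t i j) (Icc 0 T) := by
  have hFc : ∀ i j, ContinuousOn (fun t => F t i j) (Icc 0 T) :=
    fun i j t ht => ((hF t ht).1 i j).continuousWithinAt
  have hGc : ∀ i j, ContinuousOn (fun t => G t i j) (Icc 0 T) :=
    fun i j t ht => ((hF t ht).2 i j).continuousWithinAt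
  rw [contDiffOn_one_iff_derivWithin (uniqueDiffOn_Icc hT)]
  refine ⟨fun t ht => ((hF t ht).1 i j).differentiableWithinAt, ?_⟩
  refine ContinuousOn.congr (f := fun t => ((q t)⁻¹ * (G t - (B t)ᵀ * F t)) i j) ?_
    fun t ht => ((hF t ht).1 i j).derivWithin (uniqueDiffOn_Icc hT t ht)
  refine continuousOn_mul_entry (fun i j => (h.contDiffOn_q_inv i j).continuousOn)
    (N := fun t => G t - (B t)ᵀ * F t) (fun i j => (hGc i j).sub ?_) i j
  exact continuousOn_mul_entry (M := fun t => (B t)ᵀ)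
    (fun i j => (h.contDiffOn_B j i).continuousOn) hFc i j

theorem IsHamiltonianSolution.isRiccatiSolution (hF : IsHamiltonianSolution T A B q F G)
    (h : IsRegularHessian T A B q) (hT : 0 < T) (h0 : G T = 0)
    (hu : ∀ t ∈ Icc 0 T, IsUnit (F t)) :
    IsRiccatiSolution T A B q (fun t => -(q t * matDeriv T F t * (F t)⁻¹) - (B t)ᵀ) := by
  set η : ℝ → Matrix (Fin n) (Fin n) ℝ :=
    fun t => -(q t * matDeriv T F t * (F t)⁻¹) - (B t)ᵀ with hη
  have hFi : ∀ t ∈ Icc 0 T, F t * (F t)⁻¹ = 1 := fun t ht =>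
    Matrix.mul_nonsing_inv _ ((Matrix.isUnit_iff_isUnit_det _).1 (hu t ht))
  have hiF : ∀ t ∈ Icc 0 T, (F t)⁻¹ * F t = 1 := fun t ht =>
    Matrix.nonsing_inv_mul _ ((Matrix.isUnit_iff_isUnit_det _).1 (hu t ht))
  have heq : EqOn η (fun t => -(G t * (F t)⁻¹)) (Icc 0 T) := by
    intro t ht
    simp only [hη]
    rw [hF.momentum_eq h hT ht, Matrix.sub_mul, Matrix.mul_assoc, hFi t ht]
    noncomm_ring
  have hmul : EqOn (fun t => η t * F t) (fun t => -G t) (Icc 0 T) := by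
    intro t ht
    simp only [heq ht, Matrix.neg_mul, Matrix.mul_assoc, hiF t ht, Matrix.mul_one]
  have hinv : MatDifferentiable T (fun t => (F t)⁻¹) := fun i j =>
    (contDiffOn_inv_entry (N := 1) (hF.contDiffOn_entry h hT) hu i j).differentiableOn one_ne_zero
  have hdiff : MatDifferentiable T η :=
    MatDifferentiable.congr (matDifferentiable_of_hasEntryDeriv fun t ht =>
      ⟨_, ((hF t ht).2.mul (hinv.hasEntryDeriv ht)).neg⟩) heq
  -- Since `ηF = -G`, the identity `FᵀG = GᵀF` says that `FᵀηF` is symmetric; cancelling the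
  -- invertible outer factors gives symmetry of `η`.
  have hsymm : ∀ t ∈ Icc 0 T, (η t)ᵀ = η t := by
    intro t ht
    have hs := hF.symplectic h hT h0 ht
    have e1 : (F t)ᵀ * η t * F t = (F t)ᵀ * (η t)ᵀ * F t := by
      have e2 := hmul ht
      simp only at e2
      rw [Matrix.mul_assoc, e2, ← Matrix.transpose_mul, e2, Matrix.mul_neg, hs,
        Matrix.transpose_neg, Matrix.neg_mul]
    have e3 := congrArg (fun M => ((F t)⁻¹)ᵀ * M * (F t)⁻¹) e1
    have e4 : ((F t)⁻¹)ᵀ * (F t)ᵀ = 1 := by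
      rw [← Matrix.transpose_mul, hFi t ht, Matrix.transpose_one]
    have e5 : ∀ M, ((F t)⁻¹)ᵀ * ((F t)ᵀ * M * F t) * (F t)⁻¹ = M := by
      intro M
      calc _ = (((F t)⁻¹)ᵀ * (F t)ᵀ) * M * (F t * (F t)⁻¹) := by noncomm_ring
        _ = M := by rw [e4, hFi t ht, Matrix.one_mul, Matrix.mul_one]
    simp only [e5] at e3
    exact e3.symm
  have hK : ∀ t ∈ Icc 0 T,
      (gain B q η t)ᵀ * q t * gain B q η t = (B t + η t) * (q t)⁻¹ * ((B t)ᵀ + η t) := by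
    intro t ht
    rw [gain, Matrix.transpose_mul, h.symm_q_inv ht, Matrix.transpose_add,
      Matrix.transpose_transpose, hsymm t ht]
    calc _ = (B t + η t) * (q t)⁻¹ * (q t * (q t)⁻¹) * ((B t)ᵀ + η t) := by noncomm_ring
      _ = _ := by rw [h.q_mul_inv ht, Matrix.mul_one]
  refine ⟨hdiff, fun t ht => ⟨?_, hK t ht⟩, ?_⟩
  · rw [hK t ht]
    -- Differentiating the product `ηF = -G` avoids a formula for the derivative of `F⁻¹`.
    have e1 := ((hdiff.hasEntryDeriv ht).mul (hF t ht).1).unique hT ht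
      ((hF t ht).2.neg.congr hmul ht)
    have e2 : G t = -(η t * F t) := by
      have := hmul ht
      simp only at this
      rw [this, neg_neg]
    have e3 : (A t + matDeriv T η t) * F t =
        (B t + η t) * (q t)⁻¹ * ((B t)ᵀ + η t) * F t := by
      rw [e2] at e1
      rw [Matrix.add_mul, eq_sub_of_add_eq e1]
      noncomm_ring
    have e4 := congrArg (· * (F t)⁻¹) e3
    simpa only [Matrix.mul_assoc, hFi t ht, Matrix.mul_one] using e4
  · rw [heq (right_mem_Icc.2 hT.le)]
    simp [h0]

/-- Any Riccati solution `η` yields a Hamiltonian solution `(E, -ηE)` with the same terminal value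
`(I, 0)`. It therefore coincides with `(F, G)`, and `η = -G F⁻¹` is forced. -/
theorem IsHamiltonianSolution.isUniqueRiccatiSolution (hF : IsHamiltonianSolution T A B q F G)
    (h : IsRegularHessian T A B q) (hT : 0 < T) (h1 : F T = 1) (h0 : G T = 0)
    (hu : ∀ t ∈ Icc 0 T, IsUnit (F t)) :
    IsUniqueRiccatiSolution T A B q (fun t => -(q t * matDeriv T F t * (F t)⁻¹) - (B t)ᵀ) := by
  refine ⟨hF.isRiccatiSolution h hT h0 hu, fun η hη t ht => ?_⟩
  obtain ⟨E, hE, -⟩ := hη.exists_firstOrder h hT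
  obtain ⟨hEF, hG⟩ := h.hamiltonian_unique hT.le (hη.isHamiltonianSolution hE) hF
    (hE.terminal.trans h1.symm) (by simp [hη.terminal, h0])
  have hFi : F t * (F t)⁻¹ = 1 :=
    Matrix.mul_nonsing_inv _ ((Matrix.isUnit_iff_isUnit_det _).1 (hu t ht))
  have e1 : G t = -(η t * F t) := by
    rw [← hEF ht]
    exact (hG ht).symm
  have e2 : η t = -(G t * (F t)⁻¹) := by
    rw [e1, Matrix.neg_mul, neg_neg, Matrix.mul_assoc, hFi, Matrix.mul_one]
  simp only
  rw [hF.momentum_eq h hT ht, Matrix.sub_mul, Matrix.mul_assoc (B t)ᵀ, hFi, Matrix.mul_one, e2]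
  abel

end Hamiltonian

/-! ### Smooth cut-off functions with controlled slope. -/

section StepFunction

theorem exists_deriv_smoothTransition_bound :
    ∃ M : ℝ, 0 ≤ M ∧ ∀ s, deriv Real.smoothTransition s ≤ M := by
  have hc : Continuous (deriv Real.smoothTransition) :=
    (Real.smoothTransition.contDiff (n := 1)).continuous_deriv le_rfl
  obtain ⟨M, hM⟩ := (isCompact_Icc (a := (0 : ℝ)) (b := 1)).exists_bound_of_continuousOn
    hc.continuousOn
  have h0 : 0 ≤ M := (norm_nonneg _).trans (hM 0 (left_mem_Icc.2 zero_le_one))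
  refine ⟨M, h0, fun s => ?_⟩
  by_cases hs : s ∈ Icc (0 : ℝ) 1
  · exact (le_abs_self _).trans (hM s hs)
  · have hz : deriv Real.smoothTransition s = 0 := by
      rw [mem_Icc, not_and_or, not_le, not_le] at hs
      rcases hs with hs | hs
      · have : Real.smoothTransition =ᶠ[nhds s] fun _ => 0 := by
          filter_upwards [gt_mem_nhds hs] with r hr
          exact Real.smoothTransition.zero_of_nonpos hr.le
        simp [this.deriv_eq]
      · have : Real.smoothTransition =ᶠ[nhds s] fun _ => 1 := by
          filter_upwards [lt_mem_nhds hs] with r hr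
          exact Real.smoothTransition.one_of_one_le hr.le
        simp [this.deriv_eq]
    rw [hz]
    exact h0

/-- Smooth steps from `0` to `1` on `[t₀, t₀ + δ]` with slope `O(1 / δ)`. -/
theorem exists_smooth_step :
    ∃ M : ℝ, 0 ≤ M ∧ ∀ t₀ δ : ℝ, 0 < δ → ∃ η η' : ℝ → ℝ,
      (∀ t, HasDerivAt η (η' t) t) ∧ Continuous η' ∧ (∀ t ≤ t₀, η t = 0) ∧
      (∀ t, t₀ + δ ≤ t → η t = 1) ∧ (∀ t, 0 ≤ η' t) ∧ (∀ t, η' t * δ ≤ M) ∧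
      (∀ t, t ∉ Icc t₀ (t₀ + δ) → η' t = 0) := by
  obtain ⟨M, hM0, hM⟩ := exists_deriv_smoothTransition_bound
  refine ⟨M, hM0, fun t₀ δ hδ => ?_⟩
  set η : ℝ → ℝ := fun t => Real.smoothTransition ((t - t₀) / δ) with hη
  have hlow : ∀ t ≤ t₀, η t = 0 := fun t ht =>
    Real.smoothTransition.zero_of_nonpos (div_nonpos_of_nonpos_of_nonneg (by linarith) hδ.le)
  have hup : ∀ t, t₀ + δ ≤ t → η t = 1 := fun t ht =>
    Real.smoothTransition.one_of_one_le ((one_le_div hδ).2 (by linarith))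
  have hd : ∀ t, HasDerivAt η (deriv Real.smoothTransition ((t - t₀) / δ) * (1 / δ)) t := by
    intro t
    have h1 : HasDerivAt (fun t : ℝ => (t - t₀) / δ) (1 / δ) t :=
      ((hasDerivAt_id t).sub_const t₀).div_const δ
    have h2 : HasDerivAt Real.smoothTransition (deriv Real.smoothTransition ((t - t₀) / δ))
        ((t - t₀) / δ) :=
      ((Real.smoothTransition.contDiff (n := 1)).differentiable one_ne_zero _).hasDerivAt
    exact h2.comp t h1
  have hc : Continuous (deriv Real.smoothTransition) :=
    (Real.smoothTransition.contDiff (n := 1)).continuous_deriv le_rfl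
  refine ⟨η, _, hd, by fun_prop, hlow, hup, fun t => ?_, fun t => ?_, fun t ht => ?_⟩
  · exact mul_nonneg Real.smoothTransition.monotone.deriv_nonneg (by positivity)
  · rw [mul_assoc, one_div_mul_cancel hδ.ne', mul_one]
    exact hM _
  · rw [← (hd t).deriv]
    rw [mem_Icc, not_and_or, not_le, not_le] at ht
    rcases ht with ht | ht
    · have : η =ᶠ[nhds t] fun _ => 0 := by
        filter_upwards [gt_mem_nhds ht] with r hr using hlow r hr.le
      simp [this.deriv_eq]
    · have : η =ᶠ[nhds t] fun _ => 1 := by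
        filter_upwards [lt_mem_nhds ht] with r hr using hup r hr.le
      simp [this.deriv_eq]

end StepFunction

/-! ### Derivatives and continuity of products with vectors. -/

section VectorDeriv

variable {κ ι : Type*} [Fintype ι] {T t : ℝ}

theorem hasDerivWithinAt_dotProduct {a b : ℝ → ι → ℝ} {a' b' : ι → ℝ} {s : Set ℝ}
    (ha : HasDerivWithinAt a a' s t) (hb : HasDerivWithinAt b b' s t) :
    HasDerivWithinAt (fun r => a r ⬝ᵥ b r) (a' ⬝ᵥ b t + a t ⬝ᵥ b') s t := by
  simp only [dotProduct, ← Finset.sum_add_distrib]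
  exact HasDerivWithinAt.fun_sum fun i _ =>
    (hasDerivWithinAt_pi.1 ha i).fun_mul (hasDerivWithinAt_pi.1 hb i)

theorem HasEntryDeriv.mulVec {M : ℝ → Matrix κ ι ℝ} {M' : Matrix κ ι ℝ} {a : ℝ → ι → ℝ}
    {a' : ι → ℝ} (hM : HasEntryDeriv T M M' t) (ha : HasDerivWithinAt a a' (Icc 0 T) t) :
    HasDerivWithinAt (fun r => M r *ᵥ a r) (M' *ᵥ a t + M t *ᵥ a') (Icc 0 T) t :=
  hasDerivWithinAt_pi.2 fun i =>
    hasDerivWithinAt_dotProduct (hasDerivWithinAt_pi.2 fun j => hM i j) ha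

theorem continuousOn_mulVec {s : Set ℝ} {M : ℝ → Matrix κ ι ℝ} {a : ℝ → ι → ℝ}
    (hM : ∀ i j, ContinuousOn (fun t => M t i j) s) (ha : ContinuousOn a s) :
    ContinuousOn (fun t => M t *ᵥ a t) s :=
  continuousOn_pi.2 fun i => continuousOn_finsetSum _ fun j _ =>
    (hM i j).mul (continuousOn_pi.1 ha j)

theorem continuousOn_dotProduct {s : Set ℝ} {a b : ℝ → ι → ℝ}
    (ha : ContinuousOn a s) (hb : ContinuousOn b s) :
    ContinuousOn (fun t => a t ⬝ᵥ b t) s :=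
  continuousOn_finsetSum _ fun i _ => (continuousOn_pi.1 ha i).mul (continuousOn_pi.1 hb i)

end VectorDeriv

/-! ### A direction of negative second variation at a conjugate time. -/

section Variation

variable {n : ℕ} {T : ℝ} {A B q F G : ℝ → Matrix (Fin n) (Fin n) ℝ}

/-- The integrand of the second variation of the action. -/
def secondVariation (A B q : Matrix (Fin n) (Fin n) ℝ) (a b : Fin n → ℝ) : ℝ :=
  a ⬝ᵥ (A *ᵥ a) + 2 * (a ⬝ᵥ (B *ᵥ b)) + b ⬝ᵥ (q *ᵥ b)

theorem dotProduct_mulVec_comm_of_symm {M : Matrix (Fin n) (Fin n) ℝ} (hM : Mᵀ = M)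
    (a b : Fin n → ℝ) : a ⬝ᵥ (M *ᵥ b) = b ⬝ᵥ (M *ᵥ a) := by
  rw [Matrix.dotProduct_mulVec, ← Matrix.mulVec_transpose, hM, dotProduct_comm]

theorem continuousOn_secondVariation {s : Set ℝ} {a b : ℝ → Fin n → ℝ}
    (hA : ∀ i j, ContinuousOn (fun t => A t i j) s) (hB : ∀ i j, ContinuousOn (fun t => B t i j) s)
    (hq : ∀ i j, ContinuousOn (fun t => q t i j) s) (ha : ContinuousOn a s)
    (hb : ContinuousOn b s) :
    ContinuousOn (fun t => secondVariation (A t) (B t) (q t) (a t) (b t)) s :=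
  ((continuousOn_dotProduct ha (continuousOn_mulVec hA ha)).add
    (continuousOn_const.mul (continuousOn_dotProduct ha (continuousOn_mulVec hB hb)))).add
    (continuousOn_dotProduct hb (continuousOn_mulVec hq hb))

/-- Jacobi's identity for the second variation along `η h + ε k`, where `h` solves the
linearized equation. -/
theorem secondVariation_jacobi {A B q : Matrix (Fin n) (Fin n) ℝ} (hA : Aᵀ = A) (hq : qᵀ = q)
    (h d g k : Fin n → ℝ) (hg : g = q *ᵥ d + Bᵀ *ᵥ h) (η η' ε : ℝ) :
    secondVariation A B q (η • h + ε • k) (η' • h + η • d) =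
      (2 * η * η' * (h ⬝ᵥ g) + η ^ 2 * (d ⬝ᵥ g + h ⬝ᵥ (A *ᵥ h + B *ᵥ d))
        + 2 * ε * (η' * (k ⬝ᵥ g) + η * (k ⬝ᵥ (A *ᵥ h + B *ᵥ d))))
      + η' ^ 2 * (h ⬝ᵥ (q *ᵥ h)) - 2 * ε * η' * (k ⬝ᵥ (g - B *ᵥ h)) + ε ^ 2 * (k ⬝ᵥ (A *ᵥ k)) := by
  have e1 : h ⬝ᵥ (Bᵀ *ᵥ h) = h ⬝ᵥ (B *ᵥ h) := Matrix.dotProduct_transpose_mulVec _ _ _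
  have e2 : d ⬝ᵥ (Bᵀ *ᵥ h) = h ⬝ᵥ (B *ᵥ d) := Matrix.dotProduct_transpose_mulVec _ _ _
  have e3 := dotProduct_mulVec_comm_of_symm hA h k
  have e4 := dotProduct_mulVec_comm_of_symm hq d h
  subst hg
  simp only [secondVariation, Matrix.mulVec_add, Matrix.mulVec_smul, dotProduct_add, add_dotProduct,
    smul_dotProduct, dotProduct_smul, smul_eq_mul, dotProduct_sub, e1, e2, e3, e4]
  ring

/-- The direction is `ηh + εk`, with `h = F v` vanishing at `t₀`, `k` its momentum there, and `η` a
smooth step just after `t₀`. In `secondVariation_jacobi` the bracket is an exact derivative. Of the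
rest, the term linear in `ε` is negative and dominates once `η` is steep and `ε` small. The initial
cost `Q` only has to be homogeneous of degree two, as it then contributes `ε² Q k`. -/
theorem exists_negative_variation (hR : IsRegularHessian T A B q)
    (hH : IsHamiltonianSolution T A B q F G) (hT : 0 < T) (h1 : F T = 1) (h0 : G T = 0)
    {t₀ : ℝ} (ht₀ : t₀ ∈ Icc 0 T) (hs : ¬ IsUnit (F t₀)) {Q : (Fin n → ℝ) → ℝ}
    (hQ : ∀ (ε : ℝ) k, Q (ε • k) = ε ^ 2 * Q k) :
    ∃ w w' : ℝ → Fin n → ℝ, (∀ t ∈ Icc 0 T, HasDerivWithinAt w (w' t) (Icc 0 T) t) ∧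
      ContinuousOn w' (Icc 0 T) ∧
      Q (w 0) + ∫ t in (0 : ℝ)..T, secondVariation (A t) (B t) (q t) (w t) (w' t) < 0 := by
  have hTm : T ∈ Icc 0 T := right_mem_Icc.2 hT.le
  have ht₀T : t₀ < T := by
    refine lt_of_le_of_ne ht₀.2 fun h => hs ?_
    rw [h, h1]
    exact isUnit_one
  obtain ⟨v, hv, hFv⟩ : ∃ v ≠ 0, F t₀ *ᵥ v = 0 := by
    rw [Matrix.exists_mulVec_eq_zero_iff]
    by_contra hdet
    exact hs ((Matrix.isUnit_iff_isUnit_det _).2 (isUnit_iff_ne_zero.2 hdet))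
  set h : ℝ → Fin n → ℝ := fun t => F t *ᵥ v with hh
  set g : ℝ → Fin n → ℝ := fun t => G t *ᵥ v with hg
  set d : ℝ → Fin n → ℝ := fun t => (q t)⁻¹ *ᵥ (g t - (B t)ᵀ *ᵥ h t) with hd
  have hBc := fun i j => (hR.contDiffOn_B i j).continuousOn
  have hqc := fun i j => (hR.contDiffOn_q i j).continuousOn
  have hqic := fun i j => (hR.contDiffOn_q_inv i j).continuousOn
  have hhd : ∀ t ∈ Icc 0 T, HasDerivWithinAt h (d t) (Icc 0 T) t := by
    intro t ht
    refine ((hH t ht).1.mulVec (hasDerivWithinAt_const t _ v)).congr_deriv ?_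
    simp only [hd, hg, hh, Matrix.mulVec_zero, add_zero, Matrix.sub_mulVec, ← Matrix.mulVec_mulVec]
  have hgd : ∀ t ∈ Icc 0 T, HasDerivWithinAt g (A t *ᵥ h t + B t *ᵥ d t) (Icc 0 T) t := by
    intro t ht
    refine ((hH t ht).2.mulVec (hasDerivWithinAt_const t _ v)).congr_deriv ?_
    simp only [hd, hg, hh, Matrix.mulVec_zero, add_zero, Matrix.add_mulVec, Matrix.sub_mulVec,
      ← Matrix.mulVec_mulVec]
  have hgeq : ∀ t ∈ Icc 0 T, g t = q t *ᵥ d t + (B t)ᵀ *ᵥ h t := by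
    intro t ht
    simp only [hd]
    rw [Matrix.mulVec_mulVec, hR.q_mul_inv ht, Matrix.one_mulVec, sub_add_cancel]
  have hhc : ContinuousOn h (Icc 0 T) := fun t ht => (hhd t ht).continuousWithinAt
  have hgc : ContinuousOn g (Icc 0 T) := fun t ht => (hgd t ht).continuousWithinAt
  have hdc : ContinuousOn d (Icc 0 T) :=
    continuousOn_mulVec hqic (hgc.sub (continuousOn_mulVec (fun i j => hBc j i) hhc))
  have hgT : g T = 0 := by simp [hg, h0]
  have hh0 : h t₀ = 0 := hFv
  set k : Fin n → ℝ := g t₀ with hk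
  -- If `h` and `g` both vanished at `t₀`, they would vanish identically, contradicting `F T = 1`
  -- and `v ≠ 0`.
  have hk0 : k ≠ 0 := by
    intro hk0
    have key := linear_eq_zero hR.continuousOn_hamiltonianMatrix
      (u := fun t => Matrix.fromRows (F t) (G t) *ᵥ v) (fun t ht => by
        refine ((hH.hasEntryDeriv ht).mulVec (hasDerivWithinAt_const t _ v)).congr_deriv ?_
        rw [Matrix.mulVec_zero, add_zero, Matrix.mulVec_mulVec]) ht₀ (by
        funext i
        rcases i with i | i
        · exact congrFun hh0 i
        · exact congrFun hk0 i) T hTm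
    apply hv
    have : F T *ᵥ v = 0 := funext fun i => congrFun key (Sum.inl i)
    rwa [h1, Matrix.one_mulVec] at this
  have hkk : 0 < k ⬝ᵥ k := by
    refine lt_of_le_of_ne (Finset.sum_nonneg fun i _ => mul_self_nonneg _) fun h => hk0 ?_
    exact dotProduct_self_eq_zero.1 h.symm
  -- At `t₀` the factor `k ⬝ᵥ (g - B h)` equals `2c`, so it exceeds `c` nearby.
  set c : ℝ := (k ⬝ᵥ k) / 2 with hc
  have hc0 : 0 < c := by positivity
  obtain ⟨a, ha⟩ := (isCompact_Icc (a := (0 : ℝ)) (b := T)).exists_bound_of_continuousOn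
    (continuousOn_dotProduct (continuousOn_const (c := k))
      (continuousOn_mulVec hR.continuousOn_A (continuousOn_const (c := k))))
  have ha0 : 0 ≤ a := (norm_nonneg _).trans (ha T hTm)
  obtain ⟨M, hM0, hM⟩ := exists_smooth_step
  -- `ε² X` dominates all terms quadratic in `ε`; with `ε = c / X` they amount to at most `ε c`,
  -- less than the gain `3/2 ε c` below.
  set X : ℝ := a * T + |Q k| + 1 with hX
  have hX0 : 0 < X := by positivity
  set ε : ℝ := c / X with hε
  have hε0 : 0 < ε := by positivity
  have hεX : ε * X = c := div_mul_cancel₀ _ hX0.ne'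
  -- Tolerance for `h ⬝ᵥ q h = o(t - t₀)`, chosen so that rounding the corner costs at most `ε c /
  -- 2`.
  set κ : ℝ := ε * c / (2 * (M + 1)) with hκ
  have hκ0 : 0 < κ := by positivity
  have hMκ : M * κ ≤ ε * c / 2 := by
    have : κ * (M + 1) = ε * c / 2 := by
      rw [hκ]
      field_simp
    nlinarith
  -- a neighbourhood of the conjugate time on which the cross term is controlled
  have hr : HasDerivWithinAt (fun t => h t ⬝ᵥ (q t *ᵥ h t)) 0 (Icc 0 T) t₀ := by
    refine (hasDerivWithinAt_dotProduct (hhd t₀ ht₀)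
      ((hR.differentiable_q.hasEntryDeriv ht₀).mulVec (hhd t₀ ht₀))).congr_deriv ?_
    simp [hh0]
  have hev1 := (hasDerivWithinAt_iff_isLittleO.1 hr).bound hκ0
  have hev2 : ∀ᶠ t in nhdsWithin t₀ (Icc 0 T), c < k ⬝ᵥ (g t - B t *ᵥ h t) := by
    have hcont : ContinuousOn (fun t => k ⬝ᵥ (g t - B t *ᵥ h t)) (Icc 0 T) :=
      continuousOn_dotProduct continuousOn_const (hgc.sub (continuousOn_mulVec hBc hhc))
    refine (hcont t₀ ht₀).eventually (lt_mem_nhds ?_)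
    simp only [hh0, Matrix.mulVec_zero, sub_zero, ← hk]
    linarith
  obtain ⟨δ₀, hδ₀, hball⟩ := Metric.mem_nhdsWithin_iff.1 (hev1.and hev2)
  -- The step stays inside the good neighbourhood and is completed by time `T`.
  set δ : ℝ := min (δ₀ / 2) (T - t₀) with hδ
  have hδ0 : 0 < δ := lt_min (by linarith) (by linarith)
  obtain ⟨η, η', hηd, hη'c, hηl, hηu, hη'0, hη'M, hη's⟩ := hM t₀ δ hδ0
  have hη0 : η 0 = 0 := hηl 0 ht₀.1
  have hηT : η T = 1 := hηu T (by linarith [min_le_right (δ₀ / 2) (T - t₀)])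
  have hηc : Continuous η := continuous_iff_continuousAt.2 fun t => (hηd t).continuousAt
  have hηw : ∀ t, HasDerivWithinAt η (η' t) (Icc 0 T) t := fun t => (hηd t).hasDerivWithinAt
  -- The cross term gives `-2εc η'`. The corner term is at most `η' (η'δ) κ ≤ η' εc/2`, because the
  -- slope bound `η'δ ≤ M` absorbs one factor `η'`.
  have hest : ∀ t ∈ Icc 0 T,
      η' t ^ 2 * (h t ⬝ᵥ (q t *ᵥ h t)) - 2 * ε * η' t * (k ⬝ᵥ (g t - B t *ᵥ h t))
        ≤ -(3 / 2 * ε * c) * η' t := by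
    intro t ht
    by_cases hts : t ∈ Icc t₀ (t₀ + δ)
    · have hmem := hball ⟨by
        rw [Metric.mem_ball, Real.dist_eq, abs_of_nonneg (by linarith [hts.1])]
        linarith [hts.2, min_le_left (δ₀ / 2) (T - t₀)], ht⟩
      obtain ⟨hm1, hm2⟩ := hmem
      simp only [hh0, Matrix.mulVec_zero, dotProduct_zero, sub_zero, smul_zero,
        Real.norm_eq_abs] at hm1
      rw [abs_of_nonneg (show 0 ≤ t - t₀ by linarith [hts.1])] at hm1
      have hm3 : h t ⬝ᵥ (q t *ᵥ h t) ≤ κ * δ :=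
        (le_abs_self _).trans (hm1.trans (mul_le_mul_of_nonneg_left (by linarith [hts.2]) hκ0.le))
      have hm4 : η' t ^ 2 * (h t ⬝ᵥ (q t *ᵥ h t)) ≤ η' t * (ε * c / 2) :=
        calc _ ≤ η' t ^ 2 * (κ * δ) := mul_le_mul_of_nonneg_left hm3 (sq_nonneg _)
          _ = η' t * ((η' t * δ) * κ) := by ring
          _ ≤ η' t * (M * κ) := mul_le_mul_of_nonneg_left
              (mul_le_mul_of_nonneg_right (hη'M t) hκ0.le) (hη'0 t)
          _ ≤ _ := mul_le_mul_of_nonneg_left hMκ (hη'0 t)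
      have hm5 : 2 * ε * η' t * c ≤ 2 * ε * η' t * (k ⬝ᵥ (g t - B t *ᵥ h t)) :=
        mul_le_mul_of_nonneg_left hm2.le (mul_nonneg (by linarith) (hη'0 t))
      linarith
    · simp [hη's t hts]
  refine ⟨fun t => η t • h t + ε • k, fun t => η' t • h t + η t • d t, fun t ht => ?_, ?_, ?_⟩
  · refine (((hηw t).fun_smul (hhd t ht)).fun_add (hasDerivWithinAt_const t _ (ε • k))).congr_deriv ?_
    rw [add_zero, add_comm]
  · exact (hη'c.continuousOn.smul hhc).add (hηc.continuousOn.smul hdc)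
  have hwc : ContinuousOn (fun t => η t • h t + ε • k) (Icc 0 T) :=
    (hηc.continuousOn.smul hhc).add continuousOn_const
  have hw'c : ContinuousOn (fun t => η' t • h t + η t • d t) (Icc 0 T) :=
    (hη'c.continuousOn.smul hhc).add (hηc.continuousOn.smul hdc)
  -- The derivative of `P` bounds the integrand from above. Both terms containing `g` vanish at `0`,
  -- where `η = 0`, and at `T`, where `g = 0`.
  set P : ℝ → ℝ := fun t => η t ^ 2 * (h t ⬝ᵥ g t) + 2 * ε * (η t * (k ⬝ᵥ g t))
    + (-(3 / 2 * ε * c)) * η t + ε ^ 2 * a * t with hP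
  have hPd : ∀ t ∈ Icc 0 T, HasDerivWithinAt P
      ((2 * η t * η' t * (h t ⬝ᵥ g t)
        + η t ^ 2 * (d t ⬝ᵥ g t + h t ⬝ᵥ (A t *ᵥ h t + B t *ᵥ d t))
        + 2 * ε * (η' t * (k ⬝ᵥ g t) + η t * (k ⬝ᵥ (A t *ᵥ h t + B t *ᵥ d t))))
        + (-(3 / 2 * ε * c)) * η' t + ε ^ 2 * a) (Icc 0 T) t := by
    intro t ht
    have p1 := (((hηw t).fun_pow 2).fun_mul (hasDerivWithinAt_dotProduct (hhd t ht) (hgd t ht)))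
    have p2 := ((hηw t).fun_mul (hasDerivWithinAt_dotProduct
      (hasDerivWithinAt_const t _ k) (hgd t ht))).const_mul (2 * ε)
    have p3 := (hηw t).const_mul (-(3 / 2 * ε * c))
    have p4 := (hasDerivWithinAt_id t (Icc 0 T)).const_mul (ε ^ 2 * a)
    refine (((p1.fun_add p2).fun_add p3).fun_add p4).congr_deriv ?_
    simp only [zero_dotProduct, Nat.cast_ofNat, Nat.add_one_sub_one, pow_one]
    ring
  have hint := intervalIntegral.integral_le_sub_of_hasDeriv_right_of_le hT.le
    (fun t ht => (hPd t ht).continuousWithinAt)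
    (fun t ht => (hPd t ⟨ht.1.le, ht.2.le⟩).mono_of_mem_nhdsWithin
      (nhdsWithin_le_nhds (Icc_mem_nhds ht.1 ht.2)))
    (continuousOn_secondVariation hR.continuousOn_A hBc hqc hwc hw'c).integrableOn_Icc
    (fun t ht => by
      have ht' : t ∈ Icc 0 T := ⟨ht.1.le, ht.2.le⟩
      rw [secondVariation_jacobi (hR.symm_A t ht') (hR.symm_q t ht') (h t) (d t) (g t) k
        (hgeq t ht')]
      have b1 := hest t ht'
      have b2 : ε ^ 2 * (k ⬝ᵥ (A t *ᵥ k)) ≤ ε ^ 2 * a :=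
        mul_le_mul_of_nonneg_left ((le_abs_self _).trans (ha t ht')) (sq_nonneg _)
      linarith)
  have hPT : P T = -(3 / 2 * ε * c) + ε ^ 2 * a * T := by
    simp [hP, hηT, hgT]
  have hP0 : P 0 = 0 := by
    simp [hP, hη0]
  rw [hPT, hP0, sub_zero] at hint
  have hQ0 : Q (η 0 • h 0 + ε • k) = ε ^ 2 * Q k := by
    rw [hη0, zero_smul, zero_add, hQ]
  simp only [hQ0]
  have hQk : ε ^ 2 * Q k ≤ ε ^ 2 * |Q k| :=
    mul_le_mul_of_nonneg_left (le_abs_self _) (sq_nonneg _)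
  have hεc : ε ^ 2 * (a * T) + ε ^ 2 * |Q k| ≤ ε * c := by
    rw [← hεX, hX]
    nlinarith [sq_nonneg ε]
  have hpos : 0 < ε * c := mul_pos hε0 hc0
  nlinarith

end Variation

/-! ### Derivatives in the state variable, and second differences. -/

section FiberDeriv

variable {E V : Type*} [NormedAddCommGroup E] [NormedSpace ℝ E] [NormedAddCommGroup V]
  [NormedSpace ℝ V] {T t : ℝ} {N m : WithTop ℕ∞} {f f₁ f₂ : ℝ × E → V}

/-- The derivative in the second variable. -/
noncomputable def fiberDeriv (f : ℝ × E → V) (z : ℝ × E) : E →L[ℝ] V :=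
  fderiv ℝ (fun w => f (z.1, w)) z.2

theorem contDiff_fiber (hf : ContDiffOn ℝ N f (Icc 0 T ×ˢ univ)) (ht : t ∈ Icc 0 T) :
    ContDiff ℝ N (fun w => f (t, w)) := by
  rw [← contDiffOn_univ]
  exact hf.comp (by fun_prop) fun w _ => ⟨ht, trivial⟩

/-- The fibre derivative is the joint derivative within the strip, restricted to the second factor;
hence it loses just one order of joint smoothness. -/
theorem contDiffOn_fiberDeriv (hT : 0 < T) (hf : ContDiffOn ℝ N f (Icc 0 T ×ˢ univ))
    (hm : m + 1 ≤ N) : ContDiffOn ℝ m (fiberDeriv f) (Icc 0 T ×ˢ univ) := by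
  have hS : UniqueDiffOn ℝ (Icc 0 T ×ˢ (univ : Set E)) :=
    (uniqueDiffOn_Icc hT).prod uniqueDiffOn_univ
  have hN : N ≠ 0 := by
    rintro rfl
    simp at hm
  refine ((hf.fderivWithin hS hm).clm_comp
    (contDiffOn_const (c := ContinuousLinearMap.inr ℝ ℝ E))).congr fun z hz => ?_
  have h1 : HasFDerivWithinAt f (fderivWithin ℝ f (Icc 0 T ×ˢ univ) (z.1, z.2))
      (Icc 0 T ×ˢ univ) (z.1, z.2) := (hf.differentiableOn hN z hz).hasFDerivWithinAt
  have h2 : HasFDerivWithinAt (fun w : E => (z.1, w)) (ContinuousLinearMap.inr ℝ ℝ E) univ z.2 :=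
    (hasFDerivAt_prodMk_right z.1 z.2).hasFDerivWithinAt
  have h3 := h1.comp z.2 h2 fun w _ => ⟨hz.1, trivial⟩
  exact (hasFDerivWithinAt_univ.1 h3).fderiv

theorem fiberDeriv_congr (h : ∀ w, f₁ (t, w) = f₂ (t, w)) (w : E) :
    fiberDeriv f₁ (t, w) = fiberDeriv f₂ (t, w) := by
  simp only [fiberDeriv, h]

theorem hasDerivAt_line (h : Differentiable ℝ (fun w => f (t, w))) (w e : E) (r : ℝ) :
    HasDerivAt (fun s : ℝ => f (t, w + s • e)) (fiberDeriv f (t, w + r • e) e) r := by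
  have h1 : HasDerivAt (fun s : ℝ => w + s • e) e r := by
    simpa using ((hasDerivAt_id r).smul_const e).const_add w
  exact (h (w + r • e)).hasFDerivAt.comp_hasDerivAt r h1

theorem fiberDeriv_apply_eq (h : Differentiable ℝ (fun w => f (t, w))) {w e : E} {f' : V}
    (hf' : HasDerivAt (fun s : ℝ => f (t, w + s • e)) f' 0) : fiberDeriv f (t, w) e = f' := by
  have := hasDerivAt_line h w e 0
  rw [zero_smul, add_zero] at this
  exact this.unique hf'

theorem fiberDeriv_clm_apply {f : ℝ × E → E →L[ℝ] V}
    (h : Differentiable ℝ (fun w => f (t, w))) (w e e' : E) :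
    fiberDeriv (fun z => f z e') (t, w) e = fiberDeriv f (t, w) e e' := by
  have := ((h w).hasFDerivAt.clm_apply (hasFDerivAt_const e' w)).fderiv
  simp only [fiberDeriv]
  rw [this]
  simp

theorem fiberDeriv_symm {f : ℝ × E → ℝ} (hf : ContDiffOn ℝ 2 f (Icc 0 T ×ˢ univ))
    (ht : t ∈ Icc 0 T) (w e e' : E) :
    fiberDeriv (fiberDeriv f) (t, w) e e' = fiberDeriv (fiberDeriv f) (t, w) e' e :=
  ((contDiff_fiber hf ht).contDiffAt (x := w)).isSymmSndFDerivAt (by simp) e e'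

/-- Uniform upper bound of the symmetric second difference by the second derivative. -/
theorem exists_second_difference_le (hT : 0 < T) {f : ℝ × E → ℝ}
    (hf : ContDiffOn ℝ 2 f (Icc 0 T ×ˢ univ)) {γ e : ℝ → E} (hγ : ContinuousOn γ (Icc 0 T))
    (he : ContinuousOn e (Icc 0 T)) {κ : ℝ} (hκ : 0 < κ) :
    ∃ ε₀ : ℝ, 0 < ε₀ ∧ ∀ ε, 0 ≤ ε → ε ≤ ε₀ → ∀ t ∈ Icc 0 T,
      f (t, γ t + ε • e t) + f (t, γ t + (-ε) • e t) - 2 * f (t, γ t) ≤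
        ε ^ 2 * (fiberDeriv (fiberDeriv f) (t, γ t) (e t) (e t) + κ) := by
  have hD1 : ContDiffOn ℝ 1 (fiberDeriv f) (Icc 0 T ×ˢ univ) :=
    contDiffOn_fiberDeriv hT hf (by norm_num)
  have hD2 : ContDiffOn ℝ 0 (fiberDeriv (fiberDeriv f)) (Icc 0 T ×ˢ univ) :=
    contDiffOn_fiberDeriv hT hD1 (by norm_num)
  set m : ℝ × ℝ → ℝ := fun p =>
    fiberDeriv (fiberDeriv f) (p.1, γ p.1 + p.2 • e p.1) (e p.1) (e p.1) with hm
  have hfst : MapsTo Prod.fst (Icc 0 T ×ˢ Icc (-1 : ℝ) 1) (Icc 0 T) := fun p hp => hp.1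
  have hγ' := hγ.comp continuousOn_fst hfst
  have he' := he.comp continuousOn_fst hfst
  have hmc : ContinuousOn m (Icc 0 T ×ˢ Icc (-1 : ℝ) 1) := by
    have h1 : ContinuousOn (fun p : ℝ × ℝ =>
        fiberDeriv (fiberDeriv f) (p.1, γ p.1 + p.2 • e p.1)) (Icc 0 T ×ˢ Icc (-1 : ℝ) 1) :=
      hD2.continuousOn.comp
        (continuousOn_fst.prodMk (hγ'.add (continuousOn_snd.smul he')))
        fun p hp => ⟨hp.1, trivial⟩
    exact (h1.clm_apply he').clm_apply he'
  have huc := (isCompact_Icc.prod isCompact_Icc).uniformContinuousOn_of_continuous hmc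
  obtain ⟨δ, hδ, hmδ⟩ := Metric.uniformContinuousOn_iff.1 huc κ hκ
  refine ⟨min 1 (δ / 2), lt_min one_pos (by linarith), fun ε hε0 hε t ht => ?_⟩
  have hε1 : ε ≤ 1 := hε.trans (min_le_left _ _)
  have hε2 : ε ≤ δ / 2 := hε.trans (min_le_right _ _)
  -- Uniform continuity on a compact rectangle makes the choice of `ε₀` independent of `t`.
  have hbound : ∀ r ∈ Icc (-ε) ε, m (t, r) ≤ m (t, 0) + κ := by
    intro r hr
    have hr' : |r| ≤ ε := abs_le.2 hr
    have := hmδ (t, r) ⟨ht, by linarith [hr.1], by linarith [hr.2]⟩ (t, 0)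
      ⟨ht, by norm_num, by norm_num⟩ (by
        rw [Prod.dist_eq, dist_self, Real.dist_eq, sub_zero, max_eq_right (abs_nonneg _)]
        linarith)
    rw [Real.dist_eq] at this
    linarith [(abs_lt.1 this).2]
  have hd0 : Differentiable ℝ (fun w => f (t, w)) :=
    (contDiff_fiber hf ht).differentiable (by norm_num)
  have hd1 : Differentiable ℝ (fun w => fiberDeriv f (t, w)) :=
    (contDiff_fiber hD1 ht).differentiable (by norm_num)
  set b : ℝ := m (t, 0) + κ with hb
  -- As `b` bounds the second derivative along the line, this function is convex; its midpoint
  -- inequality at `±ε` is the claim.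
  have hconv : ConvexOn ℝ (Icc (-ε) ε) (fun r => b / 2 * r ^ 2 - f (t, γ t + r • e t)) := by
    have h1 : ∀ r : ℝ, HasDerivAt (fun r => b / 2 * r ^ 2 - f (t, γ t + r • e t))
        (b * r - fiberDeriv f (t, γ t + r • e t) (e t)) r := by
      intro r
      refine (((hasDerivAt_pow 2 r).const_mul (b / 2)).fun_sub
        (hasDerivAt_line hd0 (γ t) (e t) r)).congr_deriv ?_
      norm_num
      ring
    have h2 : ∀ r : ℝ, HasDerivAt (fun r => b * r - fiberDeriv f (t, γ t + r • e t) (e t))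
        (b - m (t, r)) r := by
      intro r
      have h3 := ((hasDerivAt_line hd1 (γ t) (e t) r).clm_apply (hasDerivAt_const r (e t)))
      refine (((hasDerivAt_id r).const_mul b).fun_sub h3).congr_deriv ?_
      simp [hm]
    refine convexOn_of_hasDerivWithinAt2_nonneg (convex_Icc _ _)
      (fun r _ => (h1 r).continuousAt.continuousWithinAt)
      (fun r _ => (h1 r).hasDerivWithinAt) (fun r _ => (h2 r).hasDerivWithinAt) fun r hr => ?_
    rw [interior_Icc] at hr
    linarith [hbound r ⟨hr.1.le, hr.2.le⟩]
  have hmid := hconv.2 (show ε ∈ Icc (-ε) ε from ⟨by linarith, le_rfl⟩)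
    (show -ε ∈ Icc (-ε) ε from ⟨le_rfl, by linarith⟩)
    (show (0 : ℝ) ≤ 1 / 2 by norm_num) (show (0 : ℝ) ≤ 1 / 2 by norm_num) (by norm_num)
  have hz : (1 / 2 : ℝ) • ε + (1 / 2 : ℝ) • (-ε) = 0 := by simp
  rw [hz] at hmid
  simp only [smul_eq_mul, zero_smul, add_zero] at hmid
  have hm0 : m (t, 0) = fiberDeriv (fiberDeriv f) (t, γ t) (e t) (e t) := by
    simp [hm]
  rw [← hm0]
  nlinarith

end FiberDeriv

/-! ### The second-order necessary condition for a local minimizer. -/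

section NecessaryCondition

variable {n : ℕ} {C : Type*} [NormedAddCommGroup C] [NormedSpace ℝ C] {T : ℝ}
  {Ψ : ℝ × ((Fin n → ℝ) × (Fin n → ℝ) × C) → ℝ} {c : ℝ → C} {φ : (Fin n → ℝ) → ℝ}
  {x w w' : ℝ → Fin n → ℝ}

theorem continuousOn_velocity (hT : 0 < T) (hx : ContDiffOn ℝ 1 x (Icc 0 T)) :
    ContinuousOn (velocity T x) (Icc 0 T) :=
  hx.continuousOn_derivWithin (uniqueDiffOn_Icc hT) le_rfl

theorem hasDerivWithinAt_velocity (hx : ContDiffOn ℝ 1 x (Icc 0 T)) {t : ℝ} (ht : t ∈ Icc 0 T) :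
    HasDerivWithinAt x (velocity T x t) (Icc 0 T) t :=
  (hx.differentiableOn one_ne_zero t ht).hasDerivWithinAt

theorem velocity_add_smul (hT : 0 < T) (hx : ContDiffOn ℝ 1 x (Icc 0 T))
    (hw : ∀ t ∈ Icc 0 T, HasDerivWithinAt w (w' t) (Icc 0 T) t) (r : ℝ) {t : ℝ}
    (ht : t ∈ Icc 0 T) :
    velocity T (fun t => x t + r • w t) t = velocity T x t + r • w' t :=
  ((hasDerivWithinAt_velocity hx ht).fun_add ((hw t ht).fun_const_smul r)).derivWithin
    (uniqueDiffOn_Icc hT t ht)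

theorem contDiffOn_of_hasDerivWithinAt (hT : 0 < T)
    (hw : ∀ t ∈ Icc 0 T, HasDerivWithinAt w (w' t) (Icc 0 T) t)
    (hw' : ContinuousOn w' (Icc 0 T)) : ContDiffOn ℝ 1 w (Icc 0 T) := by
  rw [contDiffOn_one_iff_derivWithin (uniqueDiffOn_Icc hT)]
  exact ⟨fun t ht => (hw t ht).differentiableWithinAt,
    hw'.congr fun t ht => (hw t ht).derivWithin (uniqueDiffOn_Icc hT t ht)⟩

/-- A direction of negative second variation excludes a local minimizer. -/
theorem not_isLocalMinimizer (hT : 0 < T) (hΨ : ContDiffOn ℝ 2 Ψ (Icc 0 T ×ˢ univ))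
    (hc : ContinuousOn c (Icc 0 T)) (hφ : ContDiff ℝ 2 φ)
    (hw : ∀ t ∈ Icc 0 T, HasDerivWithinAt w (w' t) (Icc 0 T) t) (hw' : ContinuousOn w' (Icc 0 T))
    (hneg : fderiv ℝ (fderiv ℝ φ) (x 0) (w 0) (w 0) + ∫ t in (0 : ℝ)..T,
      fiberDeriv (fiberDeriv Ψ) (t, (x t, velocity T x t, c t)) (w t, w' t, 0) (w t, w' t, 0) < 0) :
    ¬ IsLocalMinimizer T (fun t a p => Ψ (t, (a, p, c t))) φ x := by
  rintro ⟨hx, ρ, hρ, hmin⟩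
  have h0m : (0 : ℝ) ∈ Icc 0 T := left_mem_Icc.2 hT.le
  have hwC := contDiffOn_of_hasDerivWithinAt hT hw hw'
  have hwc : ContinuousOn w (Icc 0 T) := hwC.continuousOn
  set γ : ℝ → (Fin n → ℝ) × (Fin n → ℝ) × C := fun t => (x t, velocity T x t, c t) with hγd
  set e : ℝ → (Fin n → ℝ) × (Fin n → ℝ) × C := fun t => (w t, w' t, 0) with hed
  have hγ : ContinuousOn γ (Icc 0 T) :=
    hx.continuousOn.prodMk ((continuousOn_velocity hT hx).prodMk hc)
  have he : ContinuousOn e (Icc 0 T) := hwc.prodMk (hw'.prodMk continuousOn_const)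
  set H : ℝ → ℝ := fun t => fiberDeriv (fiberDeriv Ψ) (t, γ t) (e t) (e t) with hH
  set Q : ℝ := fderiv ℝ (fderiv ℝ φ) (x 0) (w 0) (w 0) with hQ
  set J : ℝ := Q + ∫ t in (0 : ℝ)..T, H t with hJ
  have hJ0 : J < 0 := hneg
  -- The errors are `κ` from `φ` and `κ T` from the integral, together `-J / 2`, which leaves `J / 2
  -- < 0`.
  set κ : ℝ := -J / (2 * (1 + T)) with hκ
  have hκ0 : 0 < κ := div_pos (by linarith) (by linarith)
  have hκJ : κ * (1 + T) = -J / 2 := by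
    rw [hκ]
    field_simp
  obtain ⟨ε₁, hε₁, h₁⟩ := exists_second_difference_le hT hΨ hγ he hκ0
  -- The initial cost is treated as a function that is constant in time.
  obtain ⟨ε₂, hε₂, h₂⟩ := exists_second_difference_le (f := fun z : ℝ × (Fin n → ℝ) => φ z.2) hT
    (hφ.comp contDiff_snd).contDiffOn (γ := fun _ => x 0) (e := fun _ => w 0) continuousOn_const
    continuousOn_const hκ0
  obtain ⟨M₁, hM₁⟩ := isCompact_Icc.exists_bound_of_continuousOn hwc
  obtain ⟨M₂, hM₂⟩ := isCompact_Icc.exists_bound_of_continuousOn hw'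
  set R : ℝ := |M₁| + |M₂| + 1 with hR
  have hR0 : 0 < R := by positivity
  -- `R` bounds both `w` and `w'`, so the paths `x ± ε w` are within `ρ` of `x` in the `C¹` sense.
  set ε : ℝ := min (min ε₁ ε₂) (ρ / (2 * R)) with hε
  have hε0 : 0 < ε := lt_min (lt_min hε₁ hε₂) (by positivity)
  have hεR : ε * R < ρ := by
    have : ε * R ≤ ρ / (2 * R) * R := mul_le_mul_of_nonneg_right (min_le_right _ _) hR0.le
    have h2 : ρ / (2 * R) * R = ρ / 2 := by field_simp
    linarith
  have hact : ∀ r : ℝ, action T (fun t a p => Ψ (t, (a, p, c t))) φ (fun t => x t + r • w t) =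
      φ (x 0 + r • w 0) + ∫ t in (0 : ℝ)..T, Ψ (t, γ t + r • e t) := by
    intro r
    simp only [action]
    congr 1
    refine intervalIntegral.integral_congr fun t ht => ?_
    rw [uIcc_of_le hT.le] at ht
    simp only [velocity_add_smul hT hx hw r ht, hγd, hed]
    simp
  have hact0 := hact 0
  simp only [zero_smul, add_zero] at hact0
  have hadm : ∀ r : ℝ, |r| ≤ ε → action T (fun t a p => Ψ (t, (a, p, c t))) φ x ≤
      action T (fun t a p => Ψ (t, (a, p, c t))) φ (fun t => x t + r • w t) := by
    intro r hr
    refine hmin _ (hx.add (hwC.const_smul r)) fun t ht => ?_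
    rw [velocity_add_smul hT hx hw r ht, add_sub_cancel_left, add_sub_cancel_left, norm_smul,
      norm_smul, Real.norm_eq_abs]
    have b1 : ‖w t‖ ≤ R := by
      linarith [hM₁ t ht, le_abs_self M₁, abs_nonneg M₂]
    have b2 : ‖w' t‖ ≤ R := by
      linarith [hM₂ t ht, le_abs_self M₂, abs_nonneg M₁]
    exact ⟨(mul_le_mul hr b1 (norm_nonneg _) hε0.le).trans_lt hεR,
      (mul_le_mul hr b2 (norm_nonneg _) hε0.le).trans_lt hεR⟩
  -- Adding the minimality inequalities for `ε` and `-ε` removes the first-order term.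
  have hp := hadm ε (abs_of_pos hε0).le
  have hn := hadm (-ε) (by rw [abs_neg, abs_of_pos hε0])
  rw [hact0, hact] at hp hn
  have hcont : ∀ r : ℝ, ContinuousOn (fun t => Ψ (t, γ t + r • e t)) (Icc 0 T) := fun r =>
    hΨ.continuousOn.comp (continuousOn_id.prodMk (hγ.add (he.const_smul r)))
      fun t ht => ⟨ht, trivial⟩
  have hII : ∀ {f : ℝ → ℝ}, ContinuousOn f (Icc 0 T) →
      IntervalIntegrable f MeasureTheory.volume 0 T := fun hf =>
    ContinuousOn.intervalIntegrable (by rwa [uIcc_of_le hT.le])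
  have hc0 : ContinuousOn (fun t => Ψ (t, γ t)) (Icc 0 T) := by simpa using hcont 0
  have hHc : ContinuousOn H (Icc 0 T) := by
    have hD1 : ContDiffOn ℝ 1 (fiberDeriv Ψ) (Icc 0 T ×ˢ univ) :=
      contDiffOn_fiberDeriv hT hΨ (by norm_num)
    have hD2 : ContDiffOn ℝ 0 (fiberDeriv (fiberDeriv Ψ)) (Icc 0 T ×ˢ univ) :=
      contDiffOn_fiberDeriv hT hD1 (by norm_num)
    have hD : ContinuousOn (fun t => fiberDeriv (fiberDeriv Ψ) (t, γ t)) (Icc 0 T) :=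
      hD2.continuousOn.comp (continuousOn_id.prodMk hγ) fun t ht => ⟨ht, trivial⟩
    exact (hD.clm_apply he).clm_apply he
  have hineq : (∫ t in (0 : ℝ)..T, (Ψ (t, γ t + ε • e t) + Ψ (t, γ t + (-ε) • e t)
      - 2 * Ψ (t, γ t))) ≤ ∫ t in (0 : ℝ)..T, ε ^ 2 * (H t + κ) :=
    intervalIntegral.integral_mono_on hT.le
      (hII (((hcont ε).add (hcont (-ε))).sub (continuousOn_const.mul hc0)))
      (hII (continuousOn_const.mul (hHc.add continuousOn_const)))
      (h₁ ε hε0.le ((min_le_left _ _).trans (min_le_left _ _)))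
  rw [intervalIntegral.integral_sub ((hII (hcont ε)).add (hII (hcont (-ε))))
      ((hII hc0).const_mul 2),
    intervalIntegral.integral_add (hII (hcont ε)) (hII (hcont (-ε))),
    intervalIntegral.integral_const_mul, intervalIntegral.integral_const_mul,
    intervalIntegral.integral_add (hII hHc) intervalIntegrable_const,
    intervalIntegral.integral_const, sub_zero, smul_eq_mul] at hineq
  have hφ2 : φ (x 0 + ε • w 0) + φ (x 0 + (-ε) • w 0) - 2 * φ (x 0) ≤ ε ^ 2 * (Q + κ) :=
    h₂ ε hε0.le ((min_le_left _ _).trans (min_le_right _ _)) 0 h0m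
  have hfin : 0 ≤ ε ^ 2 * (J + κ * (1 + T)) := by
    rw [hJ]
    linarith
  rw [hκJ] at hfin
  nlinarith [pow_pos hε0 2]

end NecessaryCondition

/-! ### The Lagrangian of the diffusion, its momentum and its regularity. -/

section Lagrangian

variable {n s : ℕ} {T : ℝ}
  {σ : ℝ → (Fin n ⊕ Fin s → ℝ) → Matrix (Fin n ⊕ Fin s) (Fin n ⊕ Fin s) ℝ}
  {μ : ℝ → (Fin n ⊕ Fin s → ℝ) → (Fin n ⊕ Fin s → ℝ)} {y : ℝ → Fin s → ℝ}
  {φ : (Fin n → ℝ) → ℝ} {x : ℝ → Fin n → ℝ}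

/-- Tuples of signal, signal velocity, observation, observation velocity. -/
abbrev PhaseSpace (n s : ℕ) : Type :=
  (Fin n → ℝ) × (Fin n → ℝ) × (Fin s → ℝ) × (Fin s → ℝ)

/-- The stacked position. -/
def stackedPos (w : PhaseSpace n s) : Fin n ⊕ Fin s → ℝ := Sum.elim w.1 w.2.2.1

/-- The stacked velocity. -/
def stackedVel (w : PhaseSpace n s) : Fin n ⊕ Fin s → ℝ := Sum.elim w.2.1 w.2.2.2

/-- The inverse volatility in the stacked position. -/
noncomputable def invVol (σ : ℝ → (Fin n ⊕ Fin s → ℝ) → Matrix (Fin n ⊕ Fin s) (Fin n ⊕ Fin s) ℝ)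
    (z : ℝ × PhaseSpace n s) : Matrix (Fin n ⊕ Fin s) (Fin n ⊕ Fin s) ℝ :=
  (σ z.1 (stackedPos z.2))⁻¹

/-- The noise intensity that drives the given velocity. -/
noncomputable def noise (σ : ℝ → (Fin n ⊕ Fin s → ℝ) → Matrix (Fin n ⊕ Fin s) (Fin n ⊕ Fin s) ℝ)
    (μ : ℝ → (Fin n ⊕ Fin s → ℝ) → (Fin n ⊕ Fin s → ℝ)) (z : ℝ × PhaseSpace n s) :
    Fin n ⊕ Fin s → ℝ :=
  invVol σ z *ᵥ (stackedVel z.2 - μ z.1 (stackedPos z.2))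

/-- The Lagrangian with the observation and its velocity as free variables. -/
noncomputable def phaseLagrangian
    (σ : ℝ → (Fin n ⊕ Fin s → ℝ) → Matrix (Fin n ⊕ Fin s) (Fin n ⊕ Fin s) ℝ)
    (μ : ℝ → (Fin n ⊕ Fin s → ℝ) → (Fin n ⊕ Fin s → ℝ)) (z : ℝ × PhaseSpace n s) : ℝ :=
  1 / 2 * (noise σ μ z ⬝ᵥ noise σ μ z)

/-- The momentum conjugate to the `j`-th signal velocity. -/
noncomputable def momentum
    (σ : ℝ → (Fin n ⊕ Fin s → ℝ) → Matrix (Fin n ⊕ Fin s) (Fin n ⊕ Fin s) ℝ)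
    (μ : ℝ → (Fin n ⊕ Fin s → ℝ) → (Fin n ⊕ Fin s → ℝ)) (j : Fin n) (z : ℝ × PhaseSpace n s) : ℝ :=
  noise σ μ z ⬝ᵥ (fun a => invVol σ z a (Sum.inl j))

/-- The `i`-th position direction. -/
def posDir (s : ℕ) (i : Fin n) : PhaseSpace n s := (Pi.single i 1, 0, 0)

/-- The `i`-th velocity direction. -/
def velDir (s : ℕ) (i : Fin n) : PhaseSpace n s := (0, Pi.single i 1, 0)

/-- The velocity of `y` is only `C¹`, so joint `C²` regularity in time is available for the
right-hand function of free variables, not in general for `ψ`. -/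
theorem lagrangian_eq (t : ℝ) (a p : Fin n → ℝ) :
    lagrangian T σ μ y t a p = phaseLagrangian σ μ (t, (a, p, y t, velocity T y t)) := rfl

theorem contDiff_stackedPos : ContDiff ℝ 2 (stackedPos (n := n) (s := s)) := by
  refine contDiff_pi.2 fun i => ?_
  rcases i with i | i <;> simp only [stackedPos, Sum.elim_inl, Sum.elim_inr] <;> fun_prop

theorem contDiff_stackedVel : ContDiff ℝ 2 (stackedVel (n := n) (s := s)) := by
  refine contDiff_pi.2 fun i => ?_
  rcases i with i | i <;> simp only [stackedVel, Sum.elim_inl, Sum.elim_inr] <;> fun_prop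

theorem contDiffOn_comp_stackedPos {V : Type*} [NormedAddCommGroup V] [NormedSpace ℝ V]
    {f : ℝ → (Fin n ⊕ Fin s → ℝ) → V}
    (hf : ContDiffOn ℝ 2 (fun w : ℝ × (Fin n ⊕ Fin s → ℝ) => f w.1 w.2) (Icc 0 T ×ˢ univ)) :
    ContDiffOn ℝ 2 (fun z : ℝ × PhaseSpace n s => f z.1 (stackedPos z.2)) (Icc 0 T ×ˢ univ) :=
  hf.comp (contDiff_fst.prodMk (contDiff_stackedPos.comp contDiff_snd)).contDiffOn
    fun _ hz => ⟨hz.1, trivial⟩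

/-- Regularity assumptions on the coefficients of the diffusion. -/
structure IsRegularDiffusion (T : ℝ)
    (σ : ℝ → (Fin n ⊕ Fin s → ℝ) → Matrix (Fin n ⊕ Fin s) (Fin n ⊕ Fin s) ℝ)
    (μ : ℝ → (Fin n ⊕ Fin s → ℝ) → (Fin n ⊕ Fin s → ℝ)) : Prop where
  contDiffOn_vol : ∀ i j, ContDiffOn ℝ 2
    (fun w : ℝ × (Fin n ⊕ Fin s → ℝ) => σ w.1 w.2 i j) (Icc 0 T ×ˢ univ)
  isUnit_vol : ∀ t ∈ Icc 0 T, ∀ z, IsUnit (σ t z)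
  contDiffOn_drift : ContDiffOn ℝ 2
    (fun w : ℝ × (Fin n ⊕ Fin s → ℝ) => μ w.1 w.2) (Icc 0 T ×ˢ univ)

namespace IsRegularDiffusion

variable (h : IsRegularDiffusion T σ μ)

include h

theorem contDiffOn_invVol (i j : Fin n ⊕ Fin s) :
    ContDiffOn ℝ 2 (fun z => invVol σ z i j) (Icc 0 T ×ˢ univ) :=
  contDiffOn_inv_entry (N := 2) (M := fun z : ℝ × PhaseSpace n s => σ z.1 (stackedPos z.2))
    (fun i j => contDiffOn_comp_stackedPos (f := fun t w => σ t w i j) (h.contDiffOn_vol i j))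
    (fun z hz => h.isUnit_vol z.1 hz.1 _) i j

theorem contDiffOn_noise : ContDiffOn ℝ 2 (noise σ μ) (Icc 0 T ×ˢ univ) := by
  refine contDiffOn_pi.2 fun i => ?_
  simp only [noise, Matrix.mulVec, dotProduct]
  refine ContDiffOn.sum fun j _ => (h.contDiffOn_invVol i j).mul ?_
  exact contDiffOn_pi.1 ((contDiff_stackedVel.comp contDiff_snd).contDiffOn.sub
    (contDiffOn_comp_stackedPos h.contDiffOn_drift)) j

theorem contDiffOn_phaseLagrangian :
    ContDiffOn ℝ 2 (phaseLagrangian σ μ) (Icc 0 T ×ˢ univ) := by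
  change ContDiffOn ℝ 2 (fun z => 1 / 2 * ∑ i, noise σ μ z i * noise σ μ z i) _
  exact contDiffOn_const.mul (ContDiffOn.sum fun i _ =>
    (contDiffOn_pi.1 h.contDiffOn_noise i).mul (contDiffOn_pi.1 h.contDiffOn_noise i))

/-- The explicit formula keeps class `C²`, where a derivative of the `C²` Lagrangian would only be
known to be `C¹`. This extra order makes `B` and `q` differentiable in time. -/
theorem contDiffOn_momentum (j : Fin n) :
    ContDiffOn ℝ 2 (momentum σ μ j) (Icc 0 T ×ˢ univ) := by
  change ContDiffOn ℝ 2 (fun z => ∑ i, noise σ μ z i * invVol σ z i (Sum.inl j)) _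
  exact ContDiffOn.sum fun i _ =>
    (contDiffOn_pi.1 h.contDiffOn_noise i).mul (h.contDiffOn_invVol i _)

omit h in
theorem stackedPos_add_velDir (w : PhaseSpace n s) (j : Fin n) (r : ℝ) :
    stackedPos (w + r • velDir s j) = stackedPos w := by
  simp [stackedPos, velDir]

omit h in
-- The noise is affine in the velocity, so the Lagrangian is quadratic and the momentum affine in
-- it.
theorem noise_add_velDir (t : ℝ) (w : PhaseSpace n s) (j : Fin n) (r : ℝ) :
    noise σ μ (t, w + r • velDir s j) =
      noise σ μ (t, w) + r • fun a => invVol σ (t, w) a (Sum.inl j) := by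
  have hv : stackedVel (w + r • velDir s j) = stackedVel w + r • Pi.single (Sum.inl j) 1 := by
    funext a
    rcases a with a | a
    · simp [stackedVel, velDir, Pi.single_apply]
    · simp [stackedVel, velDir]
  simp only [noise, invVol, stackedPos_add_velDir, hv]
  rw [add_sub_right_comm, Matrix.mulVec_add, Matrix.mulVec_smul, Matrix.mulVec_single_one]
  rfl

theorem fiberDeriv_phaseLagrangian_velDir {t : ℝ} (ht : t ∈ Icc 0 T) (w : PhaseSpace n s)
    (j : Fin n) :
    fiberDeriv (phaseLagrangian σ μ) (t, w) (velDir s j) = momentum σ μ j (t, w) := by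
  refine fiberDeriv_apply_eq
    ((contDiff_fiber h.contDiffOn_phaseLagrangian ht).differentiable (by norm_num)) ?_
  simp only [phaseLagrangian, momentum, noise_add_velDir, add_dotProduct, dotProduct_add,
    smul_dotProduct, dotProduct_smul, smul_eq_mul]
  set a := noise σ μ (t, w)
  set b : Fin n ⊕ Fin s → ℝ := fun a => invVol σ (t, w) a (Sum.inl j)
  rw [dotProduct_comm b a]
  have h1 := hasDerivAt_id (0 : ℝ)
  refine (((((h1.mul_const (a ⬝ᵥ b)).const_add (a ⬝ᵥ a)).fun_add
    ((h1.mul_const (a ⬝ᵥ b)).fun_add (h1.fun_mul (h1.mul_const (b ⬝ᵥ b)))))).const_mul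
      (1 / 2)).congr_deriv ?_ |>.congr_of_eventuallyEq (Filter.Eventually.of_forall fun r => ?_)
  · simp
    ring
  · simp
    ring

theorem fiberDeriv_momentum_velDir {t : ℝ} (ht : t ∈ Icc 0 T) (w : PhaseSpace n s)
    (i j : Fin n) :
    fiberDeriv (momentum σ μ j) (t, w) (velDir s i) =
      (fun a => invVol σ (t, w) a (Sum.inl i)) ⬝ᵥ (fun a => invVol σ (t, w) a (Sum.inl j)) := by
  refine fiberDeriv_apply_eq
    ((contDiff_fiber (h.contDiffOn_momentum j) ht).differentiable (by norm_num)) ?_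
  have hinv : ∀ r : ℝ, invVol σ (t, w + r • velDir s i) = invVol σ (t, w) := fun r => by
    simp only [invVol, stackedPos_add_velDir]
  simp only [momentum, noise_add_velDir, hinv, add_dotProduct, smul_dotProduct, smul_eq_mul]
  exact (((hasDerivAt_id (0 : ℝ)).mul_const
    ((fun a => invVol σ (t, w) a (Sum.inl i)) ⬝ᵥ fun a => invVol σ (t, w) a (Sum.inl j))).const_add
      (noise σ μ (t, w) ⬝ᵥ fun a => invVol σ (t, w) a (Sum.inl j))).congr_deriv (one_mul _)

end IsRegularDiffusion

/-- The curve in phase space of a signal path and the observation. -/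
noncomputable def phaseCurve (T : ℝ) (y : ℝ → Fin s → ℝ) (x : ℝ → Fin n → ℝ) (t : ℝ) :
    PhaseSpace n s := (x t, velocity T x t, y t, velocity T y t)

theorem fderiv_pos_eq {C : Type*} [NormedAddCommGroup C] [NormedSpace ℝ C]
    {f : ℝ × ((Fin n → ℝ) × (Fin n → ℝ) × C) → ℝ} {t : ℝ}
    (h : Differentiable ℝ (fun w => f (t, w))) (a p : Fin n → ℝ) (c : C) (e : Fin n → ℝ) :
    fderiv ℝ (fun a' => f (t, (a', p, c))) a e = fiberDeriv f (t, (a, p, c)) (e, 0, 0) := by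
  have h1 : HasFDerivAt (fun a' : Fin n → ℝ => (a', p, c))
      (ContinuousLinearMap.inl ℝ (Fin n → ℝ) ((Fin n → ℝ) × C)) a :=
    hasFDerivAt_prodMk_left a (p, c)
  have h2 := (h (a, p, c)).hasFDerivAt.comp a h1
  exact congrArg (fun L => L e) h2.fderiv

theorem fderiv_vel_eq {C : Type*} [NormedAddCommGroup C] [NormedSpace ℝ C]
    {f : ℝ × ((Fin n → ℝ) × (Fin n → ℝ) × C) → ℝ} {t : ℝ}
    (h : Differentiable ℝ (fun w => f (t, w))) (a p : Fin n → ℝ) (c : C) (e : Fin n → ℝ) :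
    fderiv ℝ (fun p' => f (t, (a, p', c))) p e = fiberDeriv f (t, (a, p, c)) (0, e, 0) := by
  have h1 : HasFDerivAt (fun p' : Fin n → ℝ => (a, p', c))
      ((ContinuousLinearMap.inr ℝ (Fin n → ℝ) ((Fin n → ℝ) × C)).comp
        (ContinuousLinearMap.inl ℝ (Fin n → ℝ) C)) p :=
    (hasFDerivAt_prodMk_right a (p, c)).comp p (hasFDerivAt_prodMk_left p c)
  have h2 := (h (a, p, c)).hasFDerivAt.comp p h1
  exact congrArg (fun L => L e) h2.fderiv

/-! ### The Hessian matrices along a path as second fibre derivatives. -/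

namespace IsRegularDiffusion

variable (h : IsRegularDiffusion T σ μ)

include h

theorem differentiable_fiber {t : ℝ} (ht : t ∈ Icc 0 T) :
    Differentiable ℝ (fun w => phaseLagrangian σ μ (t, w)) :=
  (contDiff_fiber h.contDiffOn_phaseLagrangian ht).differentiable (by norm_num)

theorem contDiffOn_fiberDeriv (hT : 0 < T) :
    ContDiffOn ℝ 1 (fiberDeriv (phaseLagrangian σ μ)) (Icc 0 T ×ˢ univ) :=
  LeastAction.contDiffOn_fiberDeriv hT h.contDiffOn_phaseLagrangian (by norm_num)

theorem differentiable_fiberDeriv (hT : 0 < T) {t : ℝ} (ht : t ∈ Icc 0 T) :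
    Differentiable ℝ (fun w => fiberDeriv (phaseLagrangian σ μ) (t, w)) :=
  (contDiff_fiber (h.contDiffOn_fiberDeriv hT) ht).differentiable (by norm_num)

theorem dX_lagrangian {t : ℝ} (ht : t ∈ Icc 0 T) (j : Fin n) (a p : Fin n → ℝ) :
    dX j (lagrangian T σ μ y) t a p =
      fiberDeriv (phaseLagrangian σ μ) (t, (a, p, y t, velocity T y t)) (posDir s j) := by
  simp only [dX, lagrangian_eq]
  exact fderiv_pos_eq (h.differentiable_fiber ht) a p _ _

theorem dP_lagrangian {t : ℝ} (ht : t ∈ Icc 0 T) (j : Fin n) (a p : Fin n → ℝ) :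
    dP j (lagrangian T σ μ y) t a p =
      fiberDeriv (phaseLagrangian σ μ) (t, (a, p, y t, velocity T y t)) (velDir s j) := by
  simp only [dP, lagrangian_eq]
  exact fderiv_vel_eq (h.differentiable_fiber ht) a p _ _

theorem hessXX_eq (hT : 0 < T) {t : ℝ} (ht : t ∈ Icc 0 T) (i j : Fin n) :
    hessXX T (lagrangian T σ μ y) x t i j =
      fiberDeriv (fiberDeriv (phaseLagrangian σ μ)) (t, phaseCurve T y x t)
        (posDir s i) (posDir s j) := by
  rw [← fiberDeriv_clm_apply (h.differentiable_fiberDeriv hT ht)]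
  simp only [hessXX, Matrix.of_apply]
  rw [dX]
  simp only [h.dX_lagrangian ht]
  exact fderiv_pos_eq (f := fun z => fiberDeriv (phaseLagrangian σ μ) z (posDir s j))
    ((h.differentiable_fiberDeriv hT ht).clm_apply (differentiable_const _)) _ _ _ _

theorem hessXP_eq (hT : 0 < T) {t : ℝ} (ht : t ∈ Icc 0 T) (i j : Fin n) :
    hessXP T (lagrangian T σ μ y) x t i j =
      fiberDeriv (fiberDeriv (phaseLagrangian σ μ)) (t, phaseCurve T y x t)
        (posDir s i) (velDir s j) := by
  rw [← fiberDeriv_clm_apply (h.differentiable_fiberDeriv hT ht)]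
  simp only [hessXP, Matrix.of_apply]
  rw [dX]
  simp only [h.dP_lagrangian ht]
  exact fderiv_pos_eq (f := fun z => fiberDeriv (phaseLagrangian σ μ) z (velDir s j))
    ((h.differentiable_fiberDeriv hT ht).clm_apply (differentiable_const _)) _ _ _ _

theorem hessPP_eq (hT : 0 < T) {t : ℝ} (ht : t ∈ Icc 0 T) (i j : Fin n) :
    hessPP T (lagrangian T σ μ y) x t i j =
      fiberDeriv (fiberDeriv (phaseLagrangian σ μ)) (t, phaseCurve T y x t)
        (velDir s i) (velDir s j) := by
  rw [← fiberDeriv_clm_apply (h.differentiable_fiberDeriv hT ht)]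
  simp only [hessPP, Matrix.of_apply]
  rw [dP]
  simp only [h.dP_lagrangian ht]
  exact fderiv_vel_eq (f := fun z => fiberDeriv (phaseLagrangian σ μ) z (velDir s j))
    ((h.differentiable_fiberDeriv hT ht).clm_apply (differentiable_const _)) _ _ _ _

theorem fiberDeriv_fiberDeriv_velDir (hT : 0 < T) {t : ℝ} (ht : t ∈ Icc 0 T) (j : Fin n)
    (w e : PhaseSpace n s) :
    fiberDeriv (fiberDeriv (phaseLagrangian σ μ)) (t, w) e (velDir s j) =
      fiberDeriv (momentum σ μ j) (t, w) e := by
  rw [← fiberDeriv_clm_apply (h.differentiable_fiberDeriv hT ht),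
    fiberDeriv_congr (f₂ := momentum σ μ j)]
  exact fun w => h.fiberDeriv_phaseLagrangian_velDir ht w j

theorem contDiffOn_fiberDeriv_momentum (hT : 0 < T) (hy : ContDiffOn ℝ 2 y (Icc 0 T))
    (hx : ContDiffOn ℝ 2 x (Icc 0 T)) (j : Fin n) (e : PhaseSpace n s) :
    ContDiffOn ℝ 1 (fun t => fiberDeriv (momentum σ μ j) (t, phaseCurve T y x t) e)
      (Icc 0 T) := by
  have hv : ∀ {m : ℕ} {u : ℝ → Fin m → ℝ}, ContDiffOn ℝ 2 u (Icc 0 T) →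
      ContDiffOn ℝ 1 (velocity T u) (Icc 0 T) := fun hu =>
    hu.derivWithin (uniqueDiffOn_Icc hT) (by norm_num)
  have hγ : ContDiffOn ℝ 1 (phaseCurve T y x) (Icc 0 T) :=
    (hx.of_le (by norm_num)).prodMk
      ((hv hx).prodMk ((hy.of_le (by norm_num)).prodMk (hv hy)))
  have hm : ContDiffOn ℝ 1 (fiberDeriv (momentum σ μ j)) (Icc 0 T ×ˢ univ) :=
    LeastAction.contDiffOn_fiberDeriv hT (h.contDiffOn_momentum j) (by norm_num)
  exact (hm.comp (contDiffOn_id.prodMk hγ) fun t ht => ⟨ht, trivial⟩).clm_apply contDiffOn_const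

/-- Here `q = RᵀR`, where `R` holds the signal columns of `σ⁻¹`. A null vector `v` of `q` satisfies
`R v = 0`, so its extension by zero lies in the kernel of the invertible `σ⁻¹`. -/
theorem isUnit_hessPP (hT : 0 < T) {t : ℝ} (ht : t ∈ Icc 0 T) :
    IsUnit (hessPP T (lagrangian T σ μ y) x t) := by
  set N := invVol σ (t, phaseCurve T y x t) with hN
  have hNu : IsUnit N := (Matrix.isUnit_nonsing_inv_iff).2 (h.isUnit_vol t ht _)
  set R : Matrix (Fin n ⊕ Fin s) (Fin n) ℝ := N.submatrix id Sum.inl with hR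
  have hq : hessPP T (lagrangian T σ μ y) x t = Rᵀ * R := by
    ext i j
    rw [h.hessPP_eq hT ht, h.fiberDeriv_fiberDeriv_velDir hT ht,
      h.fiberDeriv_momentum_velDir ht]
    rfl
  rw [hq, Matrix.isUnit_iff_isUnit_det, isUnit_iff_ne_zero, ne_eq,
    ← Matrix.exists_mulVec_eq_zero_iff]
  rintro ⟨v, hv, hv0⟩
  have h1 : R *ᵥ v = 0 := by
    rw [← dotProduct_self_eq_zero, ← Matrix.dotProduct_transpose_mulVec, Matrix.mulVec_mulVec, hv0,
      dotProduct_zero]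
  have h2 : N *ᵥ Sum.elim v 0 = 0 := by
    rw [← h1]
    funext a
    simp [hR, Matrix.mulVec, dotProduct]
  have h3 : (Sum.elim v 0 : Fin n ⊕ Fin s → ℝ) = 0 :=
    Matrix.mulVec_injective_iff_isUnit.2 hNu (by rw [h2, Matrix.mulVec_zero])
  exact hv (funext fun i => congrFun h3 (Sum.inl i))

theorem isRegularHessian (hT : 0 < T) (hy : ContDiffOn ℝ 2 y (Icc 0 T))
    (hx : ContDiffOn ℝ 2 x (Icc 0 T)) :
    IsRegularHessian T (hessXX T (lagrangian T σ μ y) x) (hessXP T (lagrangian T σ μ y) x)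
      (hessPP T (lagrangian T σ μ y) x) where
  continuousOn_A i j := by
    have hγ : ContinuousOn (phaseCurve T y x) (Icc 0 T) :=
      hx.continuousOn.prodMk ((continuousOn_velocity hT (hx.of_le (by norm_num))).prodMk
        (hy.continuousOn.prodMk (continuousOn_velocity hT (hy.of_le (by norm_num)))))
    have hD2 : ContDiffOn ℝ 0 (fiberDeriv (fiberDeriv (phaseLagrangian σ μ)))
        (Icc 0 T ×ˢ univ) :=
      LeastAction.contDiffOn_fiberDeriv hT (h.contDiffOn_fiberDeriv hT) (by norm_num)
    refine ContinuousOn.congr ?_ fun t ht => h.hessXX_eq hT ht i j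
    exact ((hD2.continuousOn.comp (continuousOn_id.prodMk hγ) fun t ht =>
      ⟨ht, trivial⟩).clm_apply continuousOn_const).clm_apply continuousOn_const
  contDiffOn_B i j :=
    (h.contDiffOn_fiberDeriv_momentum hT hy hx j (posDir s i)).congr fun t ht => by
      rw [h.hessXP_eq hT ht, h.fiberDeriv_fiberDeriv_velDir hT ht]
  contDiffOn_q i j :=
    (h.contDiffOn_fiberDeriv_momentum hT hy hx j (velDir s i)).congr fun t ht => by
      rw [h.hessPP_eq hT ht, h.fiberDeriv_fiberDeriv_velDir hT ht]
  symm_A t ht := by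
    ext i j
    rw [Matrix.transpose_apply, h.hessXX_eq hT ht, h.hessXX_eq hT ht]
    exact fiberDeriv_symm h.contDiffOn_phaseLagrangian ht _ _ _
  symm_q t ht := by
    ext i j
    rw [Matrix.transpose_apply, h.hessPP_eq hT ht, h.hessPP_eq hT ht]
    exact fiberDeriv_symm h.contDiffOn_phaseLagrangian ht _ _ _
  isUnit_q t ht := h.isUnit_hessPP hT ht

omit h in
theorem direction_eq_sum (a b : Fin n → ℝ) :
    ((a, b, 0) : PhaseSpace n s) =
      ∑ i, a i • posDir s i + ∑ i, b i • velDir s i := by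
  have hs : ∀ v : Fin n → ℝ, ∑ i, v i • (Pi.single i (1 : ℝ) : Fin n → ℝ) = v := fun v => by
    funext j
    simp [Finset.sum_apply, Pi.single_apply]
  refine Prod.ext ?_ (Prod.ext ?_ ?_)
  · simp [Prod.fst_sum, posDir, velDir, hs]
  · simp [Prod.fst_sum, Prod.snd_sum, posDir, velDir, hs]
  · simp [Prod.snd_sum, posDir, velDir]

/-- Bilinear expansion in the coordinate directions; symmetry of the second derivative merges the
two mixed blocks into `2 a ⬝ᵥ B b`. -/
theorem secondVariation_eq (hT : 0 < T) {t : ℝ} (ht : t ∈ Icc 0 T) (a b : Fin n → ℝ) :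
    secondVariation (hessXX T (lagrangian T σ μ y) x t) (hessXP T (lagrangian T σ μ y) x t)
        (hessPP T (lagrangian T σ μ y) x t) a b =
      fiberDeriv (fiberDeriv (phaseLagrangian σ μ)) (t, phaseCurve T y x t)
        (a, b, 0) (a, b, 0) := by
  set L := fiberDeriv (fiberDeriv (phaseLagrangian σ μ)) (t, phaseCurve T y x t) with hL
  have hsymm : ∀ e e', L e e' = L e' e := fun e e' =>
    fiberDeriv_symm h.contDiffOn_phaseLagrangian ht _ e e'
  have expand : ∀ (u v : Fin n → PhaseSpace n s) (a b : Fin n → ℝ),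
      L (∑ i, a i • u i) (∑ j, b j • v j) = ∑ i, ∑ j, a i * (L (u i) (v j) * b j) := by
    intro u v a b
    simp only [map_sum, map_smul, _root_.sum_apply, _root_.smul_apply,
      smul_eq_mul, Finset.mul_sum]
    rw [Finset.sum_comm]
    refine Finset.sum_congr rfl fun i _ => Finset.sum_congr rfl fun j _ => ?_
    ring
  have square : ∀ u v, L (u + v) (u + v) = L u u + 2 * L u v + L v v := by
    intro u v
    simp only [map_add, _root_.add_apply]
    rw [hsymm v u]
    ring
  rw [direction_eq_sum, square, expand, expand, expand]
  simp only [secondVariation, dotProduct, Matrix.mulVec, h.hessXX_eq hT ht, h.hessXP_eq hT ht,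
    h.hessPP_eq hT ht, ← hL, Finset.mul_sum]

end IsRegularDiffusion

end Lagrangian

end LeastAction

theorem proposition1 {n s : ℕ} {T : ℝ} (hT : 0 < T)
    -- the coefficients of the signal-observation diffusion
    (σ : ℝ → (Fin n ⊕ Fin s → ℝ) → Matrix (Fin n ⊕ Fin s) (Fin n ⊕ Fin s) ℝ)
    (μ : ℝ → (Fin n ⊕ Fin s → ℝ) → (Fin n ⊕ Fin s → ℝ))
    (hσ : ∀ i j, ContDiffOn ℝ 2
      (fun w : ℝ × (Fin n ⊕ Fin s → ℝ) => σ w.1 w.2 i j) (Icc 0 T ×ˢ univ))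
    (hσ_inv : ∀ t ∈ Icc 0 T, ∀ z, IsUnit (σ t z))
    (hμ : ContDiffOn ℝ 2
      (fun w : ℝ × (Fin n ⊕ Fin s → ℝ) => μ w.1 w.2) (Icc 0 T ×ˢ univ))
    -- the observation path and the negative logarithm of the prior density
    (y : ℝ → Fin s → ℝ) (hy : ContDiffOn ℝ 2 y (Icc 0 T))
    (φ : (Fin n → ℝ) → ℝ) (hφ : ContDiff ℝ 2 φ)
    (ψ : ℝ → (Fin n → ℝ) → (Fin n → ℝ) → ℝ) (hψ : ψ = LeastAction.lagrangian T σ μ y)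
    -- the stationary path and the second derivatives of the Lagrangian along it
    (x : ℝ → Fin n → ℝ) (hx : LeastAction.IsExtremal T ψ φ x)
    (A B q : ℝ → Matrix (Fin n) (Fin n) ℝ)
    (hA : A = LeastAction.hessXX T ψ x)
    (hB : B = LeastAction.hessXP T ψ x)
    (hq : q = LeastAction.hessPP T ψ x) :
    -- (i)
    (∀ θ : ℝ → Matrix (Fin n) (Fin n) ℝ, LeastAction.IsUniqueRiccatiSolution T A B q θ →
      ∃ F : ℝ → Matrix (Fin n) (Fin n) ℝ,
        LeastAction.IsFirstOrderSolution T (LeastAction.gain B q θ) F ∧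
        (∀ G : ℝ → Matrix (Fin n) (Fin n) ℝ,
          LeastAction.IsFirstOrderSolution T (LeastAction.gain B q θ) G → EqOn G F (Icc 0 T)) ∧
        LeastAction.IsSecondOrderSolution T A B q F) ∧
    -- the unique solution of the second-order linear problem
    (∃ F : ℝ → Matrix (Fin n) (Fin n) ℝ,
      LeastAction.IsSecondOrderSolution T A B q F ∧
      (∀ G : ℝ → Matrix (Fin n) (Fin n) ℝ,
        LeastAction.IsSecondOrderSolution T A B q G → EqOn G F (Icc 0 T)) ∧
      -- (ii)
      ((∀ t ∈ Icc 0 T, IsUnit (F t)) →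
        LeastAction.IsUniqueRiccatiSolution T A B q
          (fun t => -(q t * LeastAction.matDeriv T F t * (F t)⁻¹) - (B t)ᵀ)) ∧
      -- (iii)
      ((∃ t ∈ Icc 0 T, ¬ IsUnit (F t)) →
        ¬ LeastAction.IsLocalMinimizer T ψ φ x)) := by
  subst hψ hA hB hq
  have hreg : LeastAction.IsRegularDiffusion T σ μ := ⟨hσ, hσ_inv, hμ⟩
  have hR := hreg.isRegularHessian hT hy hx.smooth
  refine ⟨fun θ hθ => ?_, ?_⟩
  · obtain ⟨F, hF, huniq⟩ := hθ.1.exists_firstOrder hR hT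
    refine ⟨F, hF, huniq, ?_⟩
    exact (hθ.1.isHamiltonianSolution hF).isSecondOrderSolution hR hT hF.terminal
      (by simp [hθ.1.terminal])
  · obtain ⟨F, G, hH, h1, h0⟩ := hR.exists_hamiltonian hT.le
    refine ⟨F, hH.isSecondOrderSolution hR hT h1 h0,
      fun E hE => hR.secondOrder_unique hT hH h1 h0 hE,
      fun hu => hH.isUniqueRiccatiSolution hR hT h1 h0 hu, ?_⟩
    rintro ⟨t₀, ht₀, hs⟩
    -- The initial cost `Q` is the Hessian form of `φ` at the initial point of the path.
    obtain ⟨w, w', hw, hw', hneg⟩ := LeastAction.exists_negative_variation hR hH hT h1 h0 ht₀ hs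
      (Q := fun k => fderiv ℝ (fderiv ℝ φ) (x 0) k k) (fun ε k => by
        simp only [map_smul, _root_.smul_apply, smul_eq_mul]
        ring)
    refine LeastAction.not_isLocalMinimizer hT hreg.contDiffOn_phaseLagrangian
      (c := fun t => (y t, LeastAction.velocity T y t))
      (hy.continuousOn.prodMk (LeastAction.continuousOn_velocity hT (hy.of_le (by norm_num))))
      hφ hw hw' ?_
    rw [intervalIntegral.integral_congr
      (g := fun t => LeastAction.fiberDeriv (LeastAction.fiberDeriv
        (LeastAction.phaseLagrangian σ μ)) (t, LeastAction.phaseCurve T y x t)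
          (w t, w' t, 0) (w t, w' t, 0)) fun t ht => by
        rw [uIcc_of_le hT.le] at ht
        exact hreg.secondVariation_eq hT ht (w t) (w' t)] at hneg
    exact hneg
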